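/- Let $G$ be a finitely generated abelian group, let $S$ be a commutative ring, and let $R = S[X_1,\dots,X_n]$ be graded by $G$ with $\deg X_i = \gamma_i \in G$ and $\deg s = 0$ for $s \in S$. Let $B \subseteq (X_1,\dots,X_n)$ be a finitely generated graded ideal of $R$, and let $M$ be a $G$-graded $R$-module. For a $G$-graded module $N$ put $\operatorname{Supp}_G(N) = \{\gamma \in G : N_\gamma \neq 0\}$. For $l \ge 0$ put $$\mathcal{E}_l = \{\gamma_{i_1} + \cdots + \gamma_{i_l} : 1 \le i_1 < \cdots < i_l \le n\},$$ so that $\mathcal{E}_0 = \{0\}$ and $\mathcal{E}_l = \emptyset$ for $l > n$. Let $H^k_B(M)$ be the $k$-th cohomology module of the Čech complex of $M$ on a finite family $f_1,\dots,f_r$ of homogeneous generators of $B$, whose degree $k$ term is $\prod_{|I| = k} M_{f_I}$ with $I \subseteq \{1,\dots,r\}$ and $f_I = \prod_{i \in I} f_i$, with its natural $G$-grading. View $S = R/(X_1,\dots,X_n)$ as a graded $R$-module concentrated in degree $0$, and give $\operatorname{Tor}_j^R(M,S)$ the $G$-grading obtained by computing it as $H_j(M \otimes_R P_\bullet)$ for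 a graded projective resolution $P_\bullet$ of $S$. Then, for every $j \ge 0$, every such generating family $f_1, \dots, f_r$ and every such resolution $P_\bullet$, $$\operatorname{Supp}_G(\operatorname{Tor}_j^R(M,S)) \subseteq \bigcup_{k \ge 0} \bigl(\operatorname{Supp}_G(H^k_B(M)) + \mathcal{E}_{j+k}\bigr).$$ -/

import Mathlib

open CategoryTheory MonoidalCategory MvPolynomial
open scoped Pointwise TensorProduct

universe u v

noncomputable section

namespace GradedLC

/-- The support of a family `(ℋ γ)` of graded pieces: the set of degrees `γ` with `ℋ γ ≠ 0`. -/
def supp {G : Type*} {H : Type*} [AddCommGroup H] (ℋ : G → AddSubgroup H) : Set G :=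
  {γ | ℋ γ ≠ ⊥}

/-- The set of all sums `γ_{i₁} + ⋯ + γ_{iₗ}` with `i₁ < ⋯ < iₗ`. -/
def sumsOf {G : Type*} [AddCommGroup G] {n : ℕ} (γ : Fin n → G) (l : ℕ) : Set G :=
  {s | ∃ I : Finset (Fin n), I.card = l ∧ ∑ i ∈ I, γ i = s}

section Cech

variable {R : Type*} [CommRing R] {M : Type*} [AddCommGroup M] [Module R M]
variable {r : ℕ} (f : Fin r → R)

/-- The multiplicative set of the powers of `f_I = ∏_{i ∈ I} f_i`. -/
abbrev pows (I : Finset (Fin r)) : Submonoid R := Submonoid.powers (∏ i ∈ I, f i)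

theorem isUnit_pows {I J : Finset (Fin r)} (h : I ⊆ J) (x : pows f I) :
    IsUnit (algebraMap R (Module.End R (LocalizedModule (pows f J) M)) x) := by
  obtain ⟨_, t, rfl⟩ := x
  have h1 : IsUnit (algebraMap R (Localization (pows f J)) ((∏ i ∈ I, f i) ^ t)) := by
    refine isUnit_of_dvd_unit (map_dvd _ (pow_dvd_pow_of_dvd
      (Finset.prod_dvd_prod_of_subset I J f h) t)) ?_
    exact IsLocalization.map_units (Localization (pows f J))
      (⟨(∏ i ∈ J, f i) ^ t, t, rfl⟩ : pows f J)
  have h2 := h1.map (Algebra.lsmul R (A := Localization (pows f J)) R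
    (LocalizedModule (pows f J) M))
  rwa [AlgHom.commutes] at h2

/-- For `I ⊆ J`, the canonical map of localizations `M_{f_I} → M_{f_J}`. -/
def locMap (M : Type*) [AddCommGroup M] [Module R M] {I J : Finset (Fin r)} (h : I ⊆ J) :
    LocalizedModule (pows f I) M →ₗ[R] LocalizedModule (pows f J) M :=
  LocalizedModule.lift (pows f I) (LocalizedModule.mkLinearMap (pows f J) M)
    (isUnit_pows f h)

/-- The Čech cochains `Čᵏ(f; M) = ∏_{|I| = k} M_{f_I}`. -/
abbrev CechCochain (M : Type*) [AddCommGroup M] [Module R M] (k : ℕ) : Type _ :=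
  (I : {I : Finset (Fin r) // I.card = k}) → LocalizedModule (pows f I.1) M

/-- The Čech differential
`(d x)_J = ∑_{i ∈ J} (-1)^{#{j ∈ J | j < i}} x_{J \ {i}}`, for `|J| = k + 1`. -/
def cechD (M : Type*) [AddCommGroup M] [Module R M] (k : ℕ) :
    CechCochain f M k →ₗ[R] CechCochain f M (k + 1) :=
  LinearMap.pi fun J => ∑ i : {i // i ∈ J.1},
    ((-1 : R) ^ (J.1.filter (· < i.1)).card) •
      (locMap f M (Finset.erase_subset i.1 J.1)).comp
        (LinearMap.proj (⟨J.1.erase i.1, by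
          rw [Finset.card_erase_of_mem i.2, J.2, Nat.add_sub_cancel]⟩ :
            {I : Finset (Fin r) // I.card = k}))

theorem locMap_mk {I J : Finset (Fin r)} (h : I ⊆ J) (m : M) (t : ℕ) :
    locMap f M h (LocalizedModule.mk m (⟨(∏ i ∈ I, f i) ^ t, t, rfl⟩ : pows f I)) =
     LocalizedModule.mk ((∏ i ∈ J \ I, f i) ^ t • m)
      (⟨(∏ i ∈ J, f i) ^ t, t, rfl⟩ : pows f J) := by
  rw [locMap, LocalizedModule.lift_mk, Module.End.algebraMap_isUnit_inv_apply_eq_iff]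
  rw [LocalizedModule.smul'_mk]
  simp only [smul_smul]
  rw [← mul_pow, mul_comm, Finset.prod_sdiff h]
  rw [LocalizedModule.mkLinearMap_apply]
  symm
  exact LocalizedModule.mk_cancel (⟨(∏ i ∈ J, f i) ^ t, t, rfl⟩ : pows f J) m

theorem locMap_comp {I J K : Finset (Fin r)} (h : I ⊆ J) (h' : J ⊆ K)
    (x : LocalizedModule (pows f I) M) :
    locMap f M h' (locMap f M h x) = locMap f M (h.trans h') x := by
  induction x using LocalizedModule.induction_on with
  | h m s =>
    obtain ⟨_, t, rfl⟩ := s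
    have e : K \ I = (K \ J) ∪ (J \ I) := by grind
    have d : Disjoint (K \ J) (J \ I) := by
      rw [Finset.disjoint_left]; grind
    refine (congrArg _ (locMap_mk f h m t)).trans ?_
    rw [locMap_mk]
    refine Eq.trans ?_ (locMap_mk f (h.trans h') m t).symm
    rw [smul_smul, ← mul_pow, e, Finset.prod_union d]

theorem cechD_apply (k : ℕ) (x : CechCochain f M k) (J) : cechD f M k x J =
    ∑ i : {i // i ∈ J.1}, ((-1 : R) ^ (J.1.filter (· < i.1)).card) •
      (locMap f M (Finset.erase_subset i.1 J.1)) (x ⟨J.1.erase i.1, by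
          rw [Finset.card_erase_of_mem i.2, J.2, Nat.add_sub_cancel]⟩) := by
  simp [cechD]

/-- The Čech differentials form a complex. -/
theorem cechD_comp (k : ℕ) (x : CechCochain f M k) :
    cechD f M (k + 1) (cechD f M k x) = 0 := by
  funext K
  let y : Finset (Fin r) → LocalizedModule (pows f K.1) M := fun I =>
    if h : I.card = k ∧ I ⊆ K.1 then locMap f M h.2 (x ⟨I, h.1⟩) else 0
  have key : cechD f M (k + 1) (cechD f M k x) K = ∑ p ∈ K.1.sigma (fun i => K.1.erase i),
      ((-1 : R) ^ ((K.1.filter (· < p.1)).card + ((K.1.erase p.1).filter (· < p.2)).card)) •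
        y ((K.1.erase p.1).erase p.2) := by
    rw [Finset.sum_sigma, ← Finset.sum_attach, cechD_apply]
    refine Finset.sum_congr rfl fun i _ => ?_
    rw [cechD_apply, map_sum, Finset.smul_sum]
    simp only
    rw [← Finset.sum_attach (K.1.erase i.1)]
    refine Finset.sum_congr rfl fun j _ => ?_
    rw [pow_add, map_smul, smul_smul]
    congr 1
    have h1 := Finset.card_erase_of_mem i.2
    have h2 := Finset.card_erase_of_mem j.2
    have hK := K.2
    have : ((K.1.erase i.1).erase j.1).card = k ∧ (K.1.erase i.1).erase j.1 ⊆ K.1 :=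
      ⟨by omega, (Finset.erase_subset _ _).trans (Finset.erase_subset _ _)⟩
    simp only [y, dif_pos this]
    exact locMap_comp f _ _ _
  rw [key, Pi.zero_apply]
  refine Finset.sum_involution (fun p _ => ⟨p.2, p.1⟩) ?_ ?_ ?_ ?_
  · rintro ⟨i, j⟩ h
    simp only [Finset.mem_sigma, Finset.mem_erase] at h
    simp only
    rw [Finset.erase_right_comm, ← add_smul]
    refine (congrArg (· • y ((K.1.erase j).erase i)) (?_ : _ = (0 : R))).trans (zero_smul R _)
    rcases lt_or_gt_of_ne h.2.1 with hl | hl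
    · have e1 : (K.1.filter (· < i)).card = ((K.1.erase j).filter (· < i)).card + 1 := by
        rw [Finset.filter_erase, Finset.card_erase_add_one]; simp [h, hl]
      have e2 : (K.1.erase i).filter (· < j) = K.1.filter (· < j) := by
        rw [Finset.filter_erase, Finset.erase_eq_of_notMem]; simp; intro _; omega
      rw [e1, e2]; ring
    · have e1 : (K.1.filter (· < j)).card = ((K.1.erase i).filter (· < j)).card + 1 := by
        rw [Finset.filter_erase, Finset.card_erase_add_one]; simp [h, hl]
      have e2 : (K.1.erase j).filter (· < i) = K.1.filter (· < i) := by
        rw [Finset.filter_erase, Finset.erase_eq_of_notMem]; simp; intro _; omega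
      rw [e1, e2]; ring
  · rintro ⟨i, j⟩ h _ he
    simp only [Finset.mem_sigma, Finset.mem_erase] at h
    simp at he
    exact h.2.1 he.1
  · rintro ⟨i, j⟩ h
    simp only [Finset.mem_sigma, Finset.mem_erase] at h ⊢
    tauto
  · intros; rfl

/-- The Čech coboundaries in degree `k` (zero for `k = 0`). -/
def cechBoundaries (M : Type*) [AddCommGroup M] [Module R M] :
    (k : ℕ) → Submodule R (CechCochain f M k)
  | 0 => ⊥
  | k + 1 => LinearMap.range (cechD f M k)

/-- The local cohomology module `Hᵏ_B(M)`, `B = (f₁, …, f_r)`, as the `k`-th cohomology of the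
Čech complex of `M` on the generators `f₁, …, f_r`. -/
abbrev LocCoh (M : Type*) [AddCommGroup M] [Module R M] (k : ℕ) : Type _ :=
  LinearMap.ker (cechD f M k) ⧸
    (cechBoundaries f M k).comap (LinearMap.ker (cechD f M k)).subtype

section Grading

variable {G : Type*} [AddCommGroup G]
variable (δ : Fin r → G) (ℳ : G → AddSubgroup M)

/-- The degree `γ` part of `M_{f_I}`, where `f_i` is homogeneous of degree `δ_i`: the fractions
`m / f_I ^ t` with `m` homogeneous of degree `γ + t • ∑_{i ∈ I} δ_i`. -/
def locGrading (I : Finset (Fin r)) (γ : G) : AddSubgroup (LocalizedModule (pows f I) M) :=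
  AddSubgroup.closure {x | ∃ (t : ℕ) (m : M), m ∈ ℳ (γ + t • ∑ i ∈ I, δ i) ∧
    x = LocalizedModule.mk m (⟨(∏ i ∈ I, f i) ^ t, t, rfl⟩ : pows f I)}

/-- The degree `γ` part of the Čech cochains. -/
def cechGrading (k : ℕ) (γ : G) : AddSubgroup (CechCochain f M k) :=
  AddSubgroup.pi Set.univ fun I => locGrading f δ ℳ I.1 γ

/-- The degree `γ` part of `Hᵏ_B(M)`: the classes of the cocycles that are homogeneous of
degree `γ`. -/
def locCohGrading (k : ℕ) (γ : G) : AddSubgroup (LocCoh f M k) :=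
  ((cechGrading f δ ℳ k γ).comap (LinearMap.ker (cechD f M k)).subtype.toAddMonoidHom).map
    (Submodule.mkQ _).toAddMonoidHom

end Grading

end Cech

section Tor

/-- The ring `S` as a module over `S[X₁, …, X_n]`, every `X_i` acting as zero. -/
abbrev coeffModule (S : Type u) [CommRing S] (n : ℕ) : ModuleCat.{u} (MvPolynomial (Fin n) S) :=
  (ModuleCat.restrictScalars (constantCoeff (R := S) (σ := Fin n))).obj (ModuleCat.of S S)

/-- A graded projective resolution of `S` (placed in degree `0`) over `R = S[X₁, …, X_n]`,
`deg X_i = γ_i`: a projective resolution whose terms are graded `R`-modules and whose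
differentials and augmentation are homogeneous of degree `0`. -/
structure GradedResolution (S : Type u) [CommRing S] {n : ℕ} {G : Type v} [AddCommGroup G]
    [DecidableEq G] (γ : Fin n → G) where
  /-- the underlying projective resolution -/
  res : ProjectiveResolution (coeffModule S n)
  /-- the gradings of the terms -/
  grading : ∀ i : ℕ, G → AddSubgroup (res.complex.X i)
  isInternal : ∀ i, DirectSum.IsInternal (grading i)
  smul_mem : ∀ (i : ℕ) (a b : G), ∀ p ∈ weightedHomogeneousSubmodule S γ a,
    ∀ x ∈ grading i b, p • x ∈ grading i (a + b)
  d_mem : ∀ (i j : ℕ) (a : G), ∀ x ∈ grading i a, res.complex.d i j x ∈ grading j a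
  augmentation_eq_zero : ∀ a : G, a ≠ 0 → ∀ x ∈ grading 0 a, res.π.f 0 x = 0

/-- The degree `γ` part of `M ⊗_R N`, additively generated by the `m ⊗ x` with `m`, `x` homogeneous
and `deg m + deg x = γ`. -/
def tensorGrading {R : Type*} [CommRing R] {M N : Type*} [AddCommGroup M] [Module R M]
    [AddCommGroup N] [Module R N] {G : Type*} [AddCommGroup G]
    (ℳ : G → AddSubgroup M) (𝒩 : G → AddSubgroup N) (γ : G) : AddSubgroup (M ⊗[R] N) :=
  AddSubgroup.closure {z | ∃ (a b : G) (m : M) (x : N),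
    a + b = γ ∧ m ∈ ℳ a ∧ x ∈ 𝒩 b ∧ z = m ⊗ₜ[R] x}

variable {S : Type u} [CommRing S] {n : ℕ} {G : Type v} [AddCommGroup G] [DecidableEq G]
variable {γ : Fin n → G} (P : GradedResolution S γ)
variable {M : Type u} [AddCommGroup M] [Module (MvPolynomial (Fin n) S) M]

variable (S n M) in
/-- The module `Tor_j^R(M, S)` over `R = S[X₁, …, X_n]`. -/
abbrev TorMod (j : ℕ) : ModuleCat.{u} (MvPolynomial (Fin n) S) :=
  ((Tor (ModuleCat.{u} (MvPolynomial (Fin n) S)) j).obj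
    (ModuleCat.of (MvPolynomial (Fin n) S) M)).obj (coeffModule S n)

variable (M) in
/-- The complex `M ⊗_R P`. -/
abbrev tensorComplex : ChainComplex (ModuleCat.{u} (MvPolynomial (Fin n) S)) ℕ :=
  (((tensoringLeft (ModuleCat.{u} (MvPolynomial (Fin n) S))).obj
    (ModuleCat.of (MvPolynomial (Fin n) S) M)).mapHomologicalComplex _).obj P.res.complex

variable (M) in
/-- The canonical map from the `j`-cycles of `M ⊗_R P` onto `Tor_j^R(M, S)`. -/
def cyclesToTor (j : ℕ) : (tensorComplex P M).cycles j ⟶ TorMod S n M j :=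
  (tensorComplex P M).homologyπ j ≫ (P.res.isoLeftDerivedObj ((tensoringLeft _).obj
    (ModuleCat.of (MvPolynomial (Fin n) S) M)) j).inv

/-- The degree `a` part of `Tor_j^R(M, S)`: the classes of the `j`-cycles of `M ⊗_R P` that are
homogeneous of degree `a`. -/
def torGrading (ℳ : G → AddSubgroup M) (j : ℕ) (a : G) : AddSubgroup (TorMod S n M j) :=
  ((tensorGrading (R := MvPolynomial (Fin n) S) ℳ (P.grading j) a).comap
    ((tensorComplex P M).iCycles j).hom.toAddMonoidHom).map
      (cyclesToTor P M j).hom.toAddMonoidHom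

end Tor

end GradedLC

end

/-! Fix a degree `a` outside the right-hand side and consider the double complex `K_•(X; Č^•(M))`.
In the Koszul direction: for `J` nonempty, `f_J` lies in `(X_1, …, X_n)`, so `f_J = ∑ X_i q_i` with
`q_i` homogeneous. On `M_{f_J}` this gives `∑ X_i (q_i / f_J) = 1`, hence a homogeneous contraction
of the Koszul complex of `M_{f_J}` (`koszulD_contraction`). In the Čech direction: the coefficient
of `e_I` in a chain of degree `a` has degree `a - ∑_{i ∈ I} γ_i`. The choice of `a` makes the graded
piece of `H^k_B(M)` in that degree vanish whenever `|I| = j + k`, so cocycles there are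
coboundaries. A finite chase (`exists_sub_koszulD_mem_ker`) then shows that every homogeneous Koszul
`j`-cycle of degree `a` with coefficients in `M` is a boundary
(`exists_koszulD_eq_of_locCohGrading_eq_bot`).

To pass to an arbitrary graded resolution `P`, one shows that the Koszul complex resolves `S`
(`exists_koszulD_eq`) and compares the two resolutions. The degree `0` part of a chain map from `P`
to the Koszul complex is again a chain map lifting the identity, and it sends degree `a` cycles of
`M ⊗ P` to homogeneous families. The map back and the homotopy need not be graded: they only serve
to turn a Koszul boundary into a boundary of `M ⊗ P` (`mem_range_tensorD`). -/

noncomputable section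

namespace GradedLC

/-! ### Koszul chains as families indexed by finite sets, with contraction and exterior
multiplication. -/

section SuppCard

variable {σ : Type*} {N N' : Type*} [AddCommGroup N] [AddCommGroup N']

/-- The family `c` is supported on the sets of cardinality `l`. -/
def SuppCard (l : ℕ) (c : Finset σ → N) : Prop := ∀ I, I.card ≠ l → c I = 0

theorem SuppCard.comp {l : ℕ} {c : Finset σ → N} (h : SuppCard l c) (φ : N →+ N') :
    SuppCard l (φ ∘ c) := fun I hI => by simp [h I hI]

theorem SuppCard.sum {ι : Type*} {l : ℕ} (s : Finset ι) {c : ι → Finset σ → N}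
    (h : ∀ i ∈ s, SuppCard l (c i)) : SuppCard l (∑ i ∈ s, c i) := fun I hI => by
  rw [Finset.sum_apply]; exact Finset.sum_eq_zero fun i hi => h i hi I hI

theorem SuppCard.sub {l : ℕ} {c c' : Finset σ → N} (h : SuppCard l c) (h' : SuppCard l c') :
    SuppCard l (c - c') := fun I hI => by simp [h I hI, h' I hI]

end SuppCard

section Koszul

variable {σ : Type*} [LinearOrder σ] {N N' : Type*} [AddCommGroup N] [AddCommGroup N']

/-- The sign `(-1)^{#{j ∈ I | j < i}}`. -/
def wedgeSign (i : σ) (I : Finset σ) : ℤ := (-1) ^ (I.filter (· < i)).card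

theorem wedgeSign_mul_self (i : σ) (I : Finset σ) : wedgeSign i I * wedgeSign i I = 1 := by
  rw [wedgeSign, ← mul_pow]; simp

theorem wedgeSign_insert_self (i : σ) (I : Finset σ) :
    wedgeSign i (insert i I) = wedgeSign i I := by
  rw [wedgeSign, Finset.filter_insert, if_neg (lt_irrefl i), wedgeSign]

theorem wedgeSign_erase_self (i : σ) (I : Finset σ) :
    wedgeSign i (I.erase i) = wedgeSign i I := by
  rw [wedgeSign, Finset.filter_erase, Finset.erase_eq_of_notMem (by simp), wedgeSign]

theorem wedgeSign_insert {i j : σ} {I : Finset σ} (hj : j ∉ I) :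
    wedgeSign i (insert j I) = (if j < i then -1 else 1) * wedgeSign i I := by
  rw [wedgeSign, Finset.filter_insert]
  split_ifs with h
  · rw [Finset.card_insert_of_notMem (by simp [hj]), pow_succ, mul_comm, wedgeSign]
  · rw [one_mul, wedgeSign]

theorem wedgeSign_erase {i j : σ} {I : Finset σ} (hj : j ∈ I) :
    wedgeSign i (I.erase j) = (if j < i then -1 else 1) * wedgeSign i I := by
  conv_rhs => rw [← Finset.insert_erase hj, wedgeSign_insert (Finset.notMem_erase j I)]
  split_ifs <;> simp

/-- Contraction with the `i`-th dual basis vector; a family `c : Finset σ → N` stands for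
`∑_I c_I e_I` in `N ⊗ ⋀ ℤ^σ`. -/
def contract (i : σ) : (Finset σ → N) →+ (Finset σ → N) where
  toFun c I := if i ∈ I then 0 else wedgeSign i I • c (insert i I)
  map_zero' := by ext I; simp
  map_add' c c' := by ext I; by_cases h : i ∈ I <;> simp [h]

/-- Exterior multiplication by the `i`-th basis vector. -/
def wedge (i : σ) : (Finset σ → N) →+ (Finset σ → N) where
  toFun c I := if i ∈ I then wedgeSign i I • c (I.erase i) else 0
  map_zero' := by ext I; simp
  map_add' c c' := by ext I; by_cases h : i ∈ I <;> simp [h]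

theorem contract_apply (i : σ) (c : Finset σ → N) (I : Finset σ) :
    contract i c I = if i ∈ I then 0 else wedgeSign i I • c (insert i I) := rfl

theorem wedge_apply (i : σ) (c : Finset σ → N) (I : Finset σ) :
    wedge i c I = if i ∈ I then wedgeSign i I • c (I.erase i) else 0 := rfl

theorem contract_comp (φ : N →+ N') (i : σ) (c : Finset σ → N) :
    contract i (φ ∘ c) = φ ∘ contract i c := by
  ext I; simp only [contract_apply, Function.comp_apply]; split_ifs <;> simp

theorem wedge_comp (φ : N →+ N') (i : σ) (c : Finset σ → N) :
    wedge i (φ ∘ c) = φ ∘ wedge i c := by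
  ext I; simp only [wedge_apply, Function.comp_apply]; split_ifs <;> simp

theorem contract_contract (i j : σ) (c : Finset σ → N) :
    contract i (contract j c) + contract j (contract i c) = 0 := by
  ext I
  simp only [Pi.add_apply, contract_apply, Pi.zero_apply]
  rcases eq_or_ne i j with rfl | h
  · simp
  by_cases hi : i ∈ I <;> by_cases hj : j ∈ I <;> simp [hi, hj, h, h.symm, smul_smul]
  rw [wedgeSign_insert hi, wedgeSign_insert hj, Finset.insert_comm, ← add_smul]
  rcases lt_or_gt_of_ne h with h' | h' <;> simp [h', h'.not_gt, mul_comm]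

/-- With `contract_wedge` this is the Clifford relation `ι_i ε_j + ε_j ι_i = δ_ij`, on which both
Koszul homotopies below rest. -/
theorem contract_wedge_self (i : σ) (c : Finset σ → N) :
    contract i (wedge i c) + wedge i (contract i c) = c := by
  ext I
  simp only [Pi.add_apply, contract_apply, wedge_apply]
  by_cases hi : i ∈ I
  · simp [hi, smul_smul, wedgeSign_erase_self, wedgeSign_mul_self]
  · simp [hi, smul_smul, wedgeSign_insert_self, wedgeSign_mul_self]

theorem contract_wedge {i j : σ} (h : i ≠ j) (c : Finset σ → N) :
    contract i (wedge j c) + wedge j (contract i c) = 0 := by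
  ext I
  simp only [Pi.add_apply, contract_apply, wedge_apply, Pi.zero_apply]
  by_cases hi : i ∈ I <;> by_cases hj : j ∈ I <;> simp [hi, hj, h, h.symm, smul_smul]
  rw [wedgeSign_insert hi, wedgeSign_erase hj, Finset.erase_insert_of_ne h, ← add_smul]
  rcases lt_or_gt_of_ne h with h' | h' <;> simp [h', h'.not_gt, mul_comm]

theorem contract_wedge_contract {i j : σ} (h : i ≠ j) (c : Finset σ → N) :
    contract i (wedge j c) = - wedge j (contract i c) :=
  eq_neg_of_add_eq_zero_left (contract_wedge h c)

theorem SuppCard.contract {l : ℕ} {c : Finset σ → N} (h : SuppCard (l + 1) c) (i : σ) :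
    SuppCard l (contract i c) := by
  intro I hI
  rw [contract_apply]
  split_ifs with hi
  · rfl
  · rw [h, smul_zero]
    rw [Finset.card_insert_of_notMem hi]; omega

theorem contract_eq_zero {c : Finset σ → N} (h : SuppCard 0 c) (i : σ) :
    GradedLC.contract i c = 0 := by
  ext I
  rw [contract_apply]
  split_ifs with hi
  · rfl
  · rw [h, smul_zero]; rfl
    rw [Finset.card_insert_of_notMem hi]; omega

theorem SuppCard.wedge {l : ℕ} {c : Finset σ → N} (h : SuppCard l c) (i : σ) :
    SuppCard (l + 1) (wedge i c) := by
  intro I hI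
  rw [wedge_apply]
  split_ifs with hi
  · rw [h, smul_zero]
    have := Finset.card_pos.2 ⟨i, hi⟩
    rw [Finset.card_erase_of_mem hi]; omega
  · rfl

end Koszul

/-! ### The Koszul differential and its contraction. -/

section KoszulDifferential

variable {S : Type*} [CommRing S] {n : ℕ}
variable (N : Type*) [AddCommGroup N] [Module (MvPolynomial (Fin n) S) N]
variable {N' : Type*} [AddCommGroup N'] [Module (MvPolynomial (Fin n) S) N']

/-- The differential `∑_i X_i ι_i` of the Koszul complex of `X₁, …, X_n` with coefficients
in `N`. -/
def koszulD : (Finset (Fin n) → N) →ₗ[MvPolynomial (Fin n) S] (Finset (Fin n) → N) where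
  toFun c := ∑ i, (X i : MvPolynomial (Fin n) S) • contract i c
  map_add' c c' := by simp [Finset.sum_add_distrib]
  map_smul' p c := by
    rw [RingHom.id_apply, Finset.smul_sum]
    refine Finset.sum_congr rfl fun i _ => ?_
    rw [smul_comm]
    exact congrArg _ (contract_comp (DistribSMul.toAddMonoidHom N p) i c)

variable {N}

theorem koszulD_apply (c : Finset (Fin n) → N) :
    koszulD (S := S) N c = ∑ i, (X i : MvPolynomial (Fin n) S) • contract i c := rfl

theorem contract_smul (p : MvPolynomial (Fin n) S) (i : Fin n) (c : Finset (Fin n) → N) :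
    contract i (p • c) = p • contract i c :=
  contract_comp (DistribSMul.toAddMonoidHom N p) i c

theorem wedge_smul (p : MvPolynomial (Fin n) S) (i : Fin n) (c : Finset (Fin n) → N) :
    wedge i (p • c) = p • wedge i c :=
  wedge_comp (DistribSMul.toAddMonoidHom N p) i c

theorem koszulD_comp (φ : N →ₗ[MvPolynomial (Fin n) S] N') (c : Finset (Fin n) → N) :
    koszulD (S := S) N' (φ ∘ c) = φ ∘ koszulD (S := S) N c := by
  simp only [koszulD_apply]
  ext I
  simp only [Finset.sum_apply, Pi.smul_apply, Function.comp_apply, map_sum, map_smul]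
  refine Finset.sum_congr rfl fun i _ => ?_
  exact congrArg _ (congrFun (contract_comp φ.toAddMonoidHom i c) I)

theorem koszulD_koszulD (c : Finset (Fin n) → N) :
    koszulD (S := S) N (koszulD (S := S) N c) = 0 := by
  have h : ∀ i j : Fin n, contract i (contract j c) = - contract j (contract i c) := fun i j =>
    eq_neg_of_add_eq_zero_left (contract_contract i j c)
  have h0 : ∀ i : Fin n, contract i (contract i c) = 0 := fun i => by
    ext I; simp [contract_apply]
  have e : koszulD (S := S) N (koszulD (S := S) N c) = ∑ p : Fin n × Fin n,
      (X p.1 * X p.2 : MvPolynomial (Fin n) S) • contract p.1 (contract p.2 c) := by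
    rw [Fintype.sum_prod_type_right]
    simp only [koszulD_apply, map_sum, contract_smul, smul_smul, mul_comm]
  rw [e]
  refine Finset.sum_involution (fun p _ => (p.2, p.1)) ?_ ?_ ?_ ?_
  · rintro ⟨i, j⟩ -
    simp only
    rw [h i j, mul_comm, smul_neg, neg_add_cancel]
  · rintro ⟨i, j⟩ - hne he
    simp only [Prod.mk.injEq] at he
    obtain ⟨rfl, -⟩ := he
    exact hne (by simp [h0])
  · simp
  · simp

theorem SuppCard.koszulD {l : ℕ} {c : Finset (Fin n) → N} (h : SuppCard (l + 1) c) :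
    SuppCard l (koszulD (S := S) N c) := by
  rw [koszulD_apply]
  exact SuppCard.sum _ fun i _ =>
    (h.contract i).comp (DistribSMul.toAddMonoidHom N (X i : MvPolynomial (Fin n) S))

theorem koszulD_eq_zero {c : Finset (Fin n) → N} (h : SuppCard 0 c) :
    GradedLC.koszulD (S := S) N c = 0 := by
  rw [koszulD_apply]
  exact Finset.sum_eq_zero fun i _ => by rw [contract_eq_zero h, smul_zero]

/-- If `∑ X_i u_i = 1` on `N`, then `∑ u_i ε_i` contracts the Koszul complex of `N`. -/
theorem koszulD_contraction (u : Fin n → N →ₗ[MvPolynomial (Fin n) S] N)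
    (hu : ∀ x, ∑ i, (X i : MvPolynomial (Fin n) S) • u i x = x)
    {c : Finset (Fin n) → N} (hc : koszulD (S := S) N c = 0) :
    koszulD (S := S) N (∑ i, u i ∘ wedge i c) = c := by
  have e1 : koszulD (S := S) N (∑ i, u i ∘ wedge i c) =
      ∑ j, ∑ i, (X i : MvPolynomial (Fin n) S) • (u j ∘ contract i (wedge j c)) := by
    rw [map_sum]
    refine Finset.sum_congr rfl fun j _ => ?_
    rw [koszulD_apply]
    refine Finset.sum_congr rfl fun i _ => ?_
    exact congrArg _ (contract_comp (u j).toAddMonoidHom i _)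
  -- Since `c` is a cycle, this zero can be added to the sum; the Clifford relations then leave only
  -- the terms with `i = j`.
  have e2 : (0 : Finset (Fin n) → N) =
      ∑ j, ∑ i, (X i : MvPolynomial (Fin n) S) • (u j ∘ wedge j (contract i c)) := by
    symm
    refine Finset.sum_eq_zero fun j _ => ?_
    have : ∑ i, (X i : MvPolynomial (Fin n) S) • (u j ∘ wedge j (contract i c)) =
        u j ∘ wedge j (koszulD (S := S) N c) := by
      rw [koszulD_apply, map_sum]
      ext I
      simp [wedge_smul]
    rw [this, hc]
    ext I; simp
  rw [e1, ← add_zero (∑ j, _), e2, ← Finset.sum_add_distrib]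
  simp only [← Finset.sum_add_distrib, ← smul_add]
  have e3 : ∀ i j, u j ∘ contract i (wedge j c) + u j ∘ wedge j (contract i c) =
      if i = j then u j ∘ c else 0 := by
    intro i j
    have : u j ∘ contract i (wedge j c) + u j ∘ wedge j (contract i c) =
        u j ∘ (contract i (wedge j c) + wedge j (contract i c)) := by ext I; simp
    rw [this]
    split_ifs with h
    · subst h; rw [contract_wedge_self]
    · rw [contract_wedge h]; ext I; simp
  simp only [e3]
  ext I
  simp only [smul_ite, smul_zero, Finset.sum_ite_eq', Finset.mem_univ, if_true]
  conv_rhs => rw [← hu (c I)]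
  simp

end KoszulDifferential

/-! ### The Koszul complex of the polynomial ring resolves `S`. -/

section KoszulResolution

variable {S : Type*} [CommRing S] {n : ℕ}

/-- Division by `X_i`, discarding the terms not divisible by `X_i`. -/
def divX (i : Fin n) : MvPolynomial (Fin n) S →+ MvPolynomial (Fin n) S where
  toFun p := p.divMonomial (Finsupp.single i 1)
  map_zero' := zero_divMonomial _
  map_add' p q := add_divMonomial p q _

theorem divX_X_mul_self (i : Fin n) (p : MvPolynomial (Fin n) S) : divX i (X i * p) = p :=
  X_mul_divMonomial i p

theorem divX_X_mul {i j : Fin n} (h : i ≠ j) (p : MvPolynomial (Fin n) S) :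
    divX i (X j * p) = X j * divX i p := by
  ext m
  change coeff m ((X j * p).divMonomial _) = coeff m (X j * p.divMonomial _)
  rw [coeff_divMonomial, coeff_X_mul', coeff_X_mul']
  have e : j ∈ (Finsupp.single i 1 + m).support ↔ j ∈ m.support := by
    simp [h]
  by_cases hj : j ∈ m.support
  · rw [if_pos (e.2 hj), if_pos hj, coeff_divMonomial]
    congr 1
    ext k
    have : 1 ≤ m j := Nat.one_le_iff_ne_zero.2 (Finsupp.mem_support_iff.1 hj)
    simp only [Finsupp.coe_tsub, Finsupp.coe_add, Pi.sub_apply, Pi.add_apply,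
      Finsupp.single_apply]
    split_ifs <;> subst_vars <;> omega
  · rw [if_neg (mt e.1 hj), if_neg hj]

/-- Multiplying back after division projects onto the terms divisible by `X_i`; subtracting this
projection is what removes the variable. -/
theorem coeff_X_mul_divX (i : Fin n) (p : MvPolynomial (Fin n) S) (m : Fin n →₀ ℕ) :
    coeff m (X i * divX i p) = if m i = 0 then 0 else coeff m p := by
  rw [coeff_X_mul']
  by_cases hm : m i = 0
  · simp [hm]
  · rw [if_pos (Finsupp.mem_support_iff.2 hm), if_neg hm]
    change coeff _ (p.divMonomial _) = _
    rw [coeff_divMonomial, add_tsub_cancel_of_le]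
    rw [Finsupp.single_le_iff]; omega

/-- Modulo a boundary, the terms of a Koszul cycle that involve `X_i` or `e_i` can be removed. -/
theorem sub_koszulD_divX {c : Finset (Fin n) → MvPolynomial (Fin n) S}
    (hc : koszulD (S := S) _ c = 0) (i : Fin n) (I : Finset (Fin n)) (m : Fin n →₀ ℕ) :
    coeff m ((c - koszulD (S := S) _ (divX i ∘ wedge i c)) I) =
      if i ∈ I ∨ m i ≠ 0 then 0 else coeff m (c I) := by
  have e2 : divX i ∘ wedge i (koszulD (S := S) _ c) = 0 := by rw [hc]; ext I; simp
  -- With `h = divX i ∘ ε_i`, this evaluates `∂h + h∂` on the cycle `c`: for `j ≠ i`, `X_j` commutes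
  -- with `divX i` while `ι_j` anticommutes with `ε_i`, so only the terms of index `i` survive.
  have key : koszulD (S := S) _ (divX i ∘ wedge i c) =
      (fun I => X i * divX i (contract i (wedge i c) I)) + wedge i (contract i c) := by
    rw [← add_zero (koszulD _ _), ← e2, koszulD_apply, koszulD_apply, map_sum]
    have : divX i ∘ (∑ j, wedge i ((X j : MvPolynomial (Fin n) S) • contract j c)) =
        ∑ j, divX i ∘ (wedge i ((X j : MvPolynomial (Fin n) S) • contract j c)) := by
      ext I; simp
    rw [this, ← Finset.sum_add_distrib, Finset.sum_eq_single_of_mem i (Finset.mem_univ _)]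
    · congr 1
      · rw [contract_comp]; rfl
      · ext1 I
        rw [Function.comp_apply, wedge_smul]
        exact divX_X_mul_self i _
    · intro j _ hj
      rw [contract_comp, contract_wedge_contract hj, wedge_smul]
      ext1 I
      simp only [Pi.add_apply, Pi.smul_apply, Function.comp_apply, Pi.neg_apply, map_neg,
        smul_eq_mul, divX_X_mul hj.symm, Pi.zero_apply]
      ring
  have h1 := congrFun (contract_wedge_self i c) I
  rw [key]
  simp only [Pi.sub_apply, Pi.add_apply, coeff_sub, coeff_add, coeff_X_mul_divX] at h1 ⊢
  rw [← h1, coeff_add]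
  by_cases hi : i ∈ I
  · simp [hi, contract_apply]
  · by_cases hm : m i = 0 <;> simp [hi, hm, wedge_apply]

/-- The variables are eliminated one at a time with `sub_koszulD_divX`. After all of them, only the
constant term of the coefficient of `e_∅` could survive, and `h0` excludes it. -/
theorem exists_koszulD_eq {l : ℕ} {c : Finset (Fin n) → MvPolynomial (Fin n) S}
    (hl : SuppCard l c) (hc : koszulD (S := S) _ c = 0) (h0 : coeff 0 (c ∅) = 0) :
    ∃ b, SuppCard (l + 1) b ∧ koszulD (S := S) _ b = c := by
  have key : ∀ T : Finset (Fin n), ∃ b : Finset (Fin n) → MvPolynomial (Fin n) S, SuppCard (l + 1) b ∧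
      ∀ I m, coeff m ((c - koszulD (S := S) _ b) I) =
        if ∃ i ∈ T, i ∈ I ∨ m i ≠ 0 then 0 else coeff m (c I) := by
    intro T
    induction T using Finset.induction_on with
    | empty => exact ⟨0, fun _ _ => rfl, by simp⟩
    | insert i T _ ih =>
      obtain ⟨b, hb, hbc⟩ := ih
      have hz : koszulD (S := S) _ (c - koszulD (S := S) _ b) = 0 := by
        rw [map_sub, hc, koszulD_koszulD, sub_zero]
      refine ⟨b + divX i ∘ wedge i (c - koszulD (S := S) _ b), ?_, fun I m => ?_⟩
      · have h1 := ((hl.sub (hb.koszulD (S := S))).wedge i).comp (divX (S := S) i)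
        intro I hI
        rw [Pi.add_apply, hb I hI, h1 I hI, add_zero]
      · rw [map_add, ← sub_sub, sub_koszulD_divX hz, hbc]
        simp only [Finset.mem_insert, exists_eq_or_imp]
        by_cases h1 : i ∈ I ∨ m i ≠ 0 <;>
          by_cases h2 : ∃ i ∈ T, i ∈ I ∨ m i ≠ 0 <;> simp only [h1, h2, or_self, or_true,
            true_or, if_true, if_false]
  obtain ⟨b, hb, hbc⟩ := key Finset.univ
  refine ⟨b, hb, (sub_eq_zero.1 ?_).symm⟩
  ext I m
  rw [hbc, Pi.zero_apply, coeff_zero]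
  split_ifs with h
  · rfl
  · push Not at h
    have hI : I = ∅ := Finset.eq_empty_of_forall_notMem fun i => (h i (Finset.mem_univ i)).1
    have hm : m = 0 := Finsupp.ext fun i => (h i (Finset.mem_univ i)).2
    rw [hI, hm, h0]

end KoszulResolution

section

variable (S : Type u) [CommRing S] (n : ℕ)

/-- The degree `l` term of the Koszul complex of `S[X₁, …, X_n]`: the families supported on the
sets of cardinality `l`. -/
def koszulTerm (l : ℕ) :
    Submodule (MvPolynomial (Fin n) S) (Finset (Fin n) → MvPolynomial (Fin n) S) where
  carrier := {c | SuppCard l c}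
  zero_mem' _ _ := rfl
  add_mem' h h' I hI := by simp [h I hI, h' I hI]
  smul_mem' p c h I hI := by simp [h I hI]

variable {S n} in
/-- The part of a family supported on the sets of cardinality `l`. -/
def koszulProj (l : ℕ) : (Finset (Fin n) → MvPolynomial (Fin n) S) →ₗ[MvPolynomial (Fin n) S]
    koszulTerm S n l where
  toFun c := ⟨fun I => if I.card = l then c I else 0, fun I hI => if_neg hI⟩
  map_add' c c' := by ext I : 2; by_cases h : I.card = l <;> simp [h]
  map_smul' p c := by ext I : 2; by_cases h : I.card = l <;> simp [h]

theorem koszulProj_coe (l : ℕ) (c : koszulTerm S n l) : koszulProj l c.1 = c := by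
  ext I : 2
  by_cases h : I.card = l
  · simp [koszulProj, h]
  · simp [koszulProj, h, c.2 I h]

/-- Each term is a direct summand of the free module of all families. -/
instance (l : ℕ) : Module.Projective (MvPolynomial (Fin n) S) (koszulTerm S n l) :=
  Module.Projective.of_split (koszulTerm S n l).subtype (koszulProj l)
    (LinearMap.ext fun c => koszulProj_coe S n l c)

/-- The differential of the Koszul complex. -/
def koszulTermD (l : ℕ) :
    koszulTerm S n (l + 1) →ₗ[MvPolynomial (Fin n) S] koszulTerm S n l :=
  (koszulD (S := S) (MvPolynomial (Fin n) S)).restrict fun _ h => SuppCard.koszulD h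

/-- The Koszul complex of `X₁, …, X_n` on `S[X₁, …, X_n]`. -/
def koszulComplex : ChainComplex (ModuleCat.{u} (MvPolynomial (Fin n) S)) ℕ :=
  ChainComplex.of (fun l => ModuleCat.of _ (koszulTerm S n l))
    (fun l => ModuleCat.ofHom (koszulTermD S n l)) fun l => by
      refine ModuleCat.hom_ext (LinearMap.ext fun c => ?_)
      exact Subtype.ext (koszulD_koszulD c.1)

theorem koszulComplex_d (l : ℕ) :
    (koszulComplex S n).d (l + 1) l = ModuleCat.ofHom (koszulTermD S n l) :=
  ChainComplex.of_d (fun l => ModuleCat.of _ (koszulTerm S n l))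
    (fun l => ModuleCat.ofHom (koszulTermD S n l)) l

/-- The augmentation of the Koszul complex. -/
def koszulAug : ModuleCat.of (MvPolynomial (Fin n) S) (koszulTerm S n 0) ⟶ coeffModule S n :=
  ModuleCat.ofHom (Y := coeffModule S n)
    { toFun := fun c => (constantCoeff (c.1 ∅) : S)
      map_add' := fun c c' => map_add (constantCoeff (R := S)) (c.1 ∅) (c'.1 ∅)
      map_smul' := fun p c => by
        change constantCoeff (p * c.1 ∅) = constantCoeff p * constantCoeff (c.1 ∅)
        rw [map_mul] }

theorem koszulTermD_aug : (koszulComplex S n).d 1 0 ≫ koszulAug S n = 0 := by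
  rw [koszulComplex_d]
  ext c
  change constantCoeff (koszulD (S := S) _ c.1 ∅) = 0
  simp [koszulD_apply]

/-- The Koszul complex as a projective resolution of `S`. -/
def koszulResolution : ProjectiveResolution (coeffModule S n) where
  complex := koszulComplex S n
  projective l := (IsProjective.iff_projective (P := koszulTerm S n l)).1 inferInstance
  π := ((koszulComplex S n).toSingle₀Equiv _).symm ⟨koszulAug S n, koszulTermD_aug S n⟩
  quasiIso := ⟨fun l => by
    cases l with
    | zero =>
      rw [ChainComplex.quasiIsoAt₀_iff, ShortComplex.quasiIso_iff_of_zeros' _ rfl rfl rfl]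
      constructor
      · rw [ShortComplex.moduleCat_exact_iff]
        intro (c : koszulTerm S n 0) hc
        obtain ⟨b, hb, hbc⟩ := exists_koszulD_eq (S := S) c.2 (koszulD_eq_zero c.2) hc
        refine ⟨(⟨b, hb⟩ : koszulTerm S n 1), ?_⟩
        change (koszulComplex S n).d 1 0 _ = _
        rw [koszulComplex_d]
        exact Subtype.ext hbc
      · rw [ModuleCat.epi_iff_surjective]
        intro (s : S)
        refine ⟨(⟨fun I => if I = ∅ then C s else 0, fun I hI => if_neg (by
          rintro rfl; exact hI rfl)⟩ : koszulTerm S n 0), ?_⟩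
        change constantCoeff (if (∅ : Finset (Fin n)) = ∅ then C s else 0) = s
        simp
    | succ l =>
      rw [quasiIsoAt_iff_exactAt' (hL := ChainComplex.exactAt_succ_single_obj ..),
          HomologicalComplex.exactAt_iff' _ (l + 2) (l + 1) l (by simp) (by simp),
          ShortComplex.moduleCat_exact_iff]
      intro (c : koszulTerm S n (l + 1)) hc
      change (koszulComplex S n).d (l + 1) l c = 0 at hc
      rw [koszulComplex_d] at hc
      obtain ⟨b, hb, hbc⟩ := exists_koszulD_eq (S := S) c.2 (congrArg Subtype.val hc)
        (by rw [c.2 ∅ (by simp)]; simp)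
      refine ⟨(⟨b, hb⟩ : koszulTerm S n (l + 2)), ?_⟩
      change (koszulComplex S n).d (l + 2) (l + 1) _ = _
      rw [koszulComplex_d]
      exact Subtype.ext hbc⟩

theorem koszulResolution_π_zero : (koszulResolution S n).π.f 0 = koszulAug S n :=
  ChainComplex.toSingle₀Equiv_symm_apply_f_zero _ _

end

/-! ### The chase in the double complex. -/

section Chase

variable {S : Type*} [CommRing S] {n : ℕ} {G : Type*} [AddCommGroup G] (γ : Fin n → G)

/-- The family `∑_I c_I e_I` is homogeneous of degree `a`, where `deg e_I = ∑_{i ∈ I} γ_i`. -/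
def HomogeneousFamily {N : Type*} [AddCommGroup N] (𝒩 : G → AddSubgroup N) (a : G)
    (c : Finset (Fin n) → N) : Prop :=
  ∀ I, c I ∈ 𝒩 (a - ∑ i ∈ I, γ i)

variable {γ}

section

variable {N : Type*} [AddCommGroup N] {𝒩 : G → AddSubgroup N} {a : G}
  {c c' : Finset (Fin n) → N}

theorem HomogeneousFamily.sub (h : HomogeneousFamily γ 𝒩 a c)
    (h' : HomogeneousFamily γ 𝒩 a c') : HomogeneousFamily γ 𝒩 a (c - c') :=
  fun I => sub_mem (h I) (h' I)

variable [Module (MvPolynomial (Fin n) S) N]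

theorem HomogeneousFamily.koszulD
    (hX : ∀ i g, ∀ x ∈ 𝒩 g, (X i : MvPolynomial (Fin n) S) • x ∈ 𝒩 (g + γ i))
    (h : HomogeneousFamily γ 𝒩 a c) :
    HomogeneousFamily γ 𝒩 a (koszulD (S := S) N c) := by
  intro I
  rw [koszulD_apply, Finset.sum_apply]
  refine sum_mem fun i _ => ?_
  rw [Pi.smul_apply, contract_apply]
  split_ifs with hi
  · rw [smul_zero]; exact zero_mem _
  · have h1 := hX i _ _ (zsmul_mem (h (insert i I)) (wedgeSign i I))
    rw [Finset.sum_insert hi] at h1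
    convert h1 using 2
    abel

/-- Total degree is preserved because `ε_i` adds `γ_i` to the degree of the basis vector while `u i`
takes it off the coefficient. -/
theorem HomogeneousFamily.contraction {u : Fin n → N →ₗ[MvPolynomial (Fin n) S] N}
    (hu : ∀ i g, ∀ x ∈ 𝒩 g, u i x ∈ 𝒩 (g - γ i)) (h : HomogeneousFamily γ 𝒩 a c) :
    HomogeneousFamily γ 𝒩 a (∑ i, u i ∘ wedge i c) := by
  intro I
  rw [Finset.sum_apply]
  refine sum_mem fun i _ => ?_
  rw [Function.comp_apply, wedge_apply]
  split_ifs with hi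
  · have h1 := hu i _ _ (zsmul_mem (h (I.erase i)) (wedgeSign i I))
    rw [Finset.sum_erase_eq_sub hi] at h1
    convert h1 using 2
    abel
  · rw [map_zero]; exact zero_mem _

end

variable {C : ℕ → Type*} [∀ k, AddCommGroup (C k)] [∀ k, Module (MvPolynomial (Fin n) S) (C k)]
  (d : ∀ k, C k →ₗ[MvPolynomial (Fin n) S] C (k + 1)) (hdd : ∀ k x, d (k + 1) (d k x) = 0)
  (A : ∀ k, G → AddSubgroup (C k))
  (hX : ∀ k i g, ∀ x ∈ A k g, (X i : MvPolynomial (Fin n) S) • x ∈ A k (g + γ i))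
  (hd : ∀ k g, ∀ x ∈ A k g, d k x ∈ A (k + 1) g)
  (u : ∀ k, Fin n → C (k + 1) →ₗ[MvPolynomial (Fin n) S] C (k + 1))
  (hu : ∀ k x, ∑ i, (X i : MvPolynomial (Fin n) S) • u k i x = x)
  (hug : ∀ k i g, ∀ x ∈ A (k + 1) g, u k i x ∈ A (k + 1) (g - γ i))
  {r : ℕ} (hr : ∀ k, r < k → Subsingleton (C k)) (a : G) (j : ℕ)
  (hexact : ∀ k (I : Finset (Fin n)), I.card = j + (k + 1) →
    ∀ x ∈ A (k + 1) (a - ∑ i ∈ I, γ i), d (k + 1) x = 0 →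
      ∃ y ∈ A k (a - ∑ i ∈ I, γ i), d k y = x)

include hdd hX hd hu hug hr hexact in
/-- The inductive step of the comparison of the rows and the columns of the double complex
`K_•(C^•)`, whose columns of positive index are acyclic. -/
theorem exists_sub_koszulD_mem_ker (m k : ℕ) (hm : r < k + m) (c : Finset (Fin n) → C k)
    (hc : SuppCard (j + k) c) (hca : HomogeneousFamily γ (A k) a c)
    (hdc : koszulD (S := S) _ (d k ∘ c) = 0) :
    ∃ b : Finset (Fin n) → C k, SuppCard (j + k + 1) b ∧ HomogeneousFamily γ (A k) a b ∧
      d k ∘ (c - koszulD (S := S) _ b) = 0 := by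
  induction m generalizing k with
  | zero =>
    -- Beyond the last Čech column the target of `d k` is trivial, so no correction is needed.
    have := hr (k + 1) (by omega)
    exact ⟨0, fun _ _ => rfl, fun _ => zero_mem _, Subsingleton.elim _ _⟩
  | succ m ih =>
    have hdca : HomogeneousFamily γ (A (k + 1)) a (d k ∘ c) := fun I => hd k _ _ (hca I)
    -- Column `k + 1` is contractible, so the cycle `d c` lifts to `∂c' = d c`. As `∂(d c') = d(d c)
    -- = 0`, the induction hypothesis applies to `c'`.
    set c' := ∑ i, u k i ∘ wedge i (d k ∘ c) with hc'
    have e1 : koszulD (S := S) _ c' = d k ∘ c := koszulD_contraction (u k) (hu k) hdc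
    have hc's : SuppCard (j + (k + 1)) c' := SuppCard.sum _ fun i _ =>
      ((hc.comp (d k).toAddMonoidHom).wedge i).comp (u k i).toAddMonoidHom
    obtain ⟨b', hb's, hb'a, hb'⟩ := ih (k + 1) (by omega) c' hc's
      (hdca.contraction (hug k)) (by
        rw [koszulD_comp, e1]
        ext I
        exact hdd k (c I))
    have hs : SuppCard (j + (k + 1)) (c' - koszulD (S := S) _ b') := hc's.sub hb's.koszulD
    -- Čech exactness solves `d b = c' - ∂b'` coefficientwise. Off cardinality `j + k + 1` the right
    -- side vanishes and `0` is chosen, so that `b` has the required support.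
    have hb : ∀ I : Finset (Fin n), ∃ y, (I.card ≠ j + k + 1 → y = 0) ∧
        y ∈ A k (a - ∑ i ∈ I, γ i) ∧ d k y = (c' - koszulD (S := S) _ b') I := by
      intro I
      by_cases hI : I.card = j + (k + 1)
      · obtain ⟨y, hy, hy'⟩ := hexact k I hI _
          (((hdca.contraction (hug k)).sub (hb'a.koszulD (hX (k + 1)))) I) (congrFun hb' I)
        exact ⟨y, fun h => absurd hI h, hy, hy'⟩
      · exact ⟨0, fun _ => rfl, zero_mem _, by rw [map_zero, hs I hI]⟩
    choose b hbs hba hb using hb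
    have e2 : d k ∘ b = c' - koszulD (S := S) _ b' := funext hb
    refine ⟨b, hbs, hba, ?_⟩
    -- `d ∂b = ∂ d b = ∂c' - ∂∂b' = d c`.
    have e3 : d k ∘ koszulD (S := S) _ b = d k ∘ c := by
      rw [← koszulD_comp, e2, map_sub, e1, koszulD_koszulD, sub_zero]
    ext I
    have := congrFun e3 I
    simp only [Function.comp_apply, Pi.sub_apply, map_sub] at this ⊢
    rw [this, sub_self, Pi.zero_apply]

-- The chase, started in column `0` with `m = r + 1`, yields `d(c - ∂b) = 0`; injectivity of `d 0`
-- in the relevant degrees then gives `c = ∂b`.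
include hdd hX hd hu hug hr hexact in
theorem exists_koszulD_eq_of_acyclic
    (hexact₀ : ∀ I : Finset (Fin n), I.card = j →
      ∀ x ∈ A 0 (a - ∑ i ∈ I, γ i), d 0 x = 0 → x = 0)
    (c : Finset (Fin n) → C 0) (hc : SuppCard j c) (hca : HomogeneousFamily γ (A 0) a c)
    (hdc : koszulD (S := S) _ c = 0) :
    ∃ b : Finset (Fin n) → C 0, SuppCard (j + 1) b ∧ koszulD (S := S) _ b = c := by
  obtain ⟨b, hb, hba, h⟩ := exists_sub_koszulD_mem_ker d hdd A hX hd u hu hug hr a j hexact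
    (r + 1) 0 (by omega) c hc hca (by rw [koszulD_comp, hdc]; ext I; simp)
  refine ⟨b, hb, (sub_eq_zero.1 (_root_.funext fun I => ?_)).symm⟩
  by_cases hI : I.card = j
  · exact hexact₀ I hI _ ((hca.sub (hba.koszulD (hX 0))) I) (congrFun h I)
  · exact (hc.sub hb.koszulD) I hI

end Chase

/-! ### Homogeneous multipliers, homogeneous fractions and the grading of the Čech complex. -/

section HomogeneousSMul

variable {R : Type*} [CommRing R] {M : Type*} [AddCommGroup M] [Module R M]
variable {G : Type*} [AddCommGroup G] (ℳ : G → AddSubgroup M)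

/-- Multiplication by `p` raises degrees by `δ`. -/
def HomogeneousSMul (p : R) (δ : G) : Prop := ∀ g, ∀ m ∈ ℳ g, p • m ∈ ℳ (g + δ)

variable {ℳ}

theorem HomogeneousSMul.one : HomogeneousSMul ℳ (1 : R) 0 := fun g m hm => by
  rwa [one_smul, add_zero]

theorem HomogeneousSMul.mul {p q : R} {δ ε : G} (hp : HomogeneousSMul ℳ p δ)
    (hq : HomogeneousSMul ℳ q ε) : HomogeneousSMul ℳ (p * q) (δ + ε) := fun g m hm => by
  rw [mul_smul, add_comm δ, ← add_assoc]
  exact hp _ _ (hq _ _ hm)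

theorem HomogeneousSMul.pow {p : R} {δ : G} (hp : HomogeneousSMul ℳ p δ) (t : ℕ) :
    HomogeneousSMul ℳ (p ^ t) (t • δ) := by
  induction t with
  | zero => simpa using HomogeneousSMul.one
  | succ t ih => rw [pow_succ, succ_nsmul]; exact ih.mul hp

theorem HomogeneousSMul.prod {ι : Type*} (s : Finset ι) {p : ι → R} {δ : ι → G}
    (h : ∀ i ∈ s, HomogeneousSMul ℳ (p i) (δ i)) :
    HomogeneousSMul ℳ (∏ i ∈ s, p i) (∑ i ∈ s, δ i) := by
  classical
  induction s using Finset.induction_on with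
  | empty => simpa using HomogeneousSMul.one
  | insert i s hi ih =>
    rw [Finset.prod_insert hi, Finset.sum_insert hi]
    exact (h i (Finset.mem_insert_self i s)).mul
      (ih fun j hj => h j (Finset.mem_insert_of_mem hj))

theorem HomogeneousSMul.decompose_smul [DecidableEq G] [DirectSum.Decomposition ℳ] {p : R} {δ : G}
    (hp : HomogeneousSMul ℳ p δ) (m : M) {a b : G} (hab : b + δ = a) :
    (DirectSum.decompose ℳ (p • m) a : M) = p • (DirectSum.decompose ℳ m b : M) := by
  subst hab
  induction m using DirectSum.Decomposition.inductionOn ℳ with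
  | zero => simp
  | @homogeneous i m =>
    by_cases hi : i = b
    · subst hi
      rw [DirectSum.decompose_of_mem_same ℳ (hp _ _ m.2), DirectSum.decompose_of_mem_same ℳ m.2]
    · rw [DirectSum.decompose_of_mem_ne ℳ (hp _ _ m.2) (by simpa using hi),
        DirectSum.decompose_of_mem_ne ℳ m.2 hi, smul_zero]
  | add m m' h h' =>
    simp only [smul_add, DirectSum.decompose_add, DirectSum.add_apply, AddSubgroup.coe_add, h, h']

end HomogeneousSMul

section Fractions

variable {R : Type*} [CommRing R] {M : Type*} [AddCommGroup M] [Module R M]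
variable {r : ℕ} (f : Fin r → R)

/-- The fraction `m / f_I ^ t`. -/
def frac (I : Finset (Fin r)) (t : ℕ) : M →ₗ[R] LocalizedModule (pows f I) M :=
  LocalizedModule.divBy ⟨(∏ i ∈ I, f i) ^ t, t, rfl⟩ ∘ₗ LocalizedModule.mkLinearMap _ _

theorem frac_apply (I : Finset (Fin r)) (t : ℕ) (m : M) :
    frac f I t m = LocalizedModule.mk m (⟨(∏ i ∈ I, f i) ^ t, t, rfl⟩ : pows f I) := by
  rw [frac, LinearMap.comp_apply, LocalizedModule.mkLinearMap_apply, LocalizedModule.divBy_apply,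
    LocalizedModule.liftOn_mk, one_mul]

theorem exists_frac {I : Finset (Fin r)} (x : LocalizedModule (pows f I) M) :
    ∃ t m, x = frac f I t m := by
  induction x using LocalizedModule.induction_on with
  | h m s =>
    obtain ⟨_, t, rfl⟩ := s
    exact ⟨t, m, (frac_apply f I t m).symm⟩

theorem frac_add_pow (I : Finset (Fin r)) (t s : ℕ) (m : M) :
    frac f I (t + s) ((∏ i ∈ I, f i) ^ s • m) = frac f I t m := by
  rw [frac_apply, frac_apply, LocalizedModule.mk_eq]
  refine ⟨1, ?_⟩
  simp only [Submonoid.smul_def, smul_smul, one_smul, ← pow_add]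

theorem frac_eq_frac {I : Finset (Fin r)} {t s : ℕ} {m m' : M} :
    frac f I t m = frac f I s m' ↔
      ∃ v, (∏ i ∈ I, f i) ^ (v + s) • m = (∏ i ∈ I, f i) ^ (v + t) • m' := by
  rw [frac_apply, frac_apply, LocalizedModule.mk_eq]
  constructor
  · rintro ⟨⟨_, v, rfl⟩, h⟩
    refine ⟨v, ?_⟩
    simpa only [Submonoid.smul_def, smul_smul, ← pow_add] using h
  · rintro ⟨v, h⟩
    refine ⟨⟨_, v, rfl⟩, ?_⟩
    simpa only [Submonoid.smul_def, smul_smul, ← pow_add] using h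

/-- There are finitely many components, so one exponent, the largest, serves them all. -/
theorem exists_forall_frac {k : ℕ} (x : CechCochain f M k) :
    ∃ (t : ℕ) (m : {I : Finset (Fin r) // I.card = k} → M), ∀ I, x I = frac f I.1 t (m I) := by
  choose t m h using fun I => exists_frac f (x I)
  refine ⟨Finset.univ.sup t,
    fun I => (∏ i ∈ I.1, f i) ^ (Finset.univ.sup t - t I) • m I, fun I => ?_⟩
  have h1 : t I + (Finset.univ.sup t - t I) = Finset.univ.sup t :=
    Nat.add_sub_cancel' (Finset.le_sup (Finset.mem_univ I))
  have h2 := frac_add_pow f I.1 (t I) (Finset.univ.sup t - t I) (m I)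
  rw [h1] at h2
  rw [h, h2]

theorem locMap_frac {I J : Finset (Fin r)} (h : I ⊆ J) (t : ℕ) (m : M) :
    locMap f M h (frac f I t m) = frac f J t ((∏ i ∈ J \ I, f i) ^ t • m) := by
  rw [frac_apply, frac_apply]
  exact locMap_mk f h m t

theorem divBy_frac (I : Finset (Fin r)) (t : ℕ) (m : M) :
    LocalizedModule.divBy (⟨∏ i ∈ I, f i, 1, pow_one _⟩ : pows f I) (frac f I t m) =
      frac f I (t + 1) m := by
  rw [frac_apply, frac_apply, LocalizedModule.divBy_apply, LocalizedModule.liftOn_mk]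
  congr 1
  exact Subtype.ext (pow_succ _ _).symm

variable {G : Type*} [AddCommGroup G] {δ : Fin r → G} {ℳ : G → AddSubgroup M}

variable {f} in
theorem frac_mem_locGrading {I : Finset (Fin r)} {t : ℕ} {m : M} {g : G}
    (hm : m ∈ ℳ (g + t • ∑ i ∈ I, δ i)) : frac f I t m ∈ locGrading f δ ℳ I g :=
  AddSubgroup.subset_closure ⟨t, m, hm, frac_apply f I t m⟩

variable {f} (hf : ∀ i, HomogeneousSMul ℳ (f i) (δ i))

-- Passing to a common denominator keeps numerators homogeneous, so the generators of the closure
-- already form a subgroup.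
include hf in
theorem mem_locGrading {I : Finset (Fin r)} {g : G} {x : LocalizedModule (pows f I) M} :
    x ∈ locGrading f δ ℳ I g ↔
      ∃ (t : ℕ) (m : M), m ∈ ℳ (g + t • ∑ i ∈ I, δ i) ∧ x = frac f I t m := by
  have hfI : HomogeneousSMul ℳ (∏ i ∈ I, f i) (∑ i ∈ I, δ i) :=
    HomogeneousSMul.prod _ fun i _ => hf i
  constructor
  · intro hx
    induction hx using AddSubgroup.closure_induction with
    | mem x hx =>
      obtain ⟨t, m, hm, rfl⟩ := hx
      exact ⟨t, m, hm, (frac_apply f I t m).symm⟩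
    | zero => exact ⟨0, 0, zero_mem _, (map_zero _).symm⟩
    | add x y _ _ hx hy =>
      obtain ⟨t, m, hm, rfl⟩ := hx
      obtain ⟨s, m', hm', rfl⟩ := hy
      refine ⟨t + s, (∏ i ∈ I, f i) ^ s • m + (∏ i ∈ I, f i) ^ t • m', add_mem ?_ ?_, ?_⟩
      · have := hfI.pow s _ _ hm
        rwa [add_assoc, ← add_smul] at this
      · have := hfI.pow t _ _ hm'
        rwa [add_assoc, ← add_smul, add_comm s t] at this
      · rw [map_add, frac_add_pow, add_comm t s, frac_add_pow]
    | neg x _ hx =>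
      obtain ⟨t, m, hm, rfl⟩ := hx
      exact ⟨t, -m, neg_mem hm, (map_neg _ _).symm⟩
  · rintro ⟨t, m, hm, rfl⟩
    exact frac_mem_locGrading hm

include hf in
/-- The numerator of a homogeneous fraction can be replaced by its homogeneous component. -/
theorem frac_decompose [DecidableEq G] [DirectSum.Decomposition ℳ] {I : Finset (Fin r)} {g : G}
    {t : ℕ} {m : M} (h : frac f I t m ∈ locGrading f δ ℳ I g) :
    frac f I t (DirectSum.decompose ℳ m (g + t • ∑ i ∈ I, δ i) : M) = frac f I t m := by
  have hfI : HomogeneousSMul ℳ (∏ i ∈ I, f i) (∑ i ∈ I, δ i) :=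
    HomogeneousSMul.prod _ fun i _ => hf i
  obtain ⟨s, m', hm', e⟩ := (mem_locGrading hf).1 h
  rw [e]
  obtain ⟨v, hv⟩ := (frac_eq_frac f).1 e
  refine (frac_eq_frac f).2 ⟨v, ?_⟩
  -- Taking one homogeneous component of both sides of `hv` replaces `m` by its component and leaves
  -- the homogeneous `m'` unchanged.
  rw [← (hfI.pow (v + s)).decompose_smul m rfl, hv,
    (hfI.pow (v + t)).decompose_smul m' (b := g + s • ∑ i ∈ I, δ i),
    DirectSum.decompose_of_mem_same ℳ hm']
  simp only [add_smul]; abel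

theorem mem_cechGrading {k : ℕ} {g : G} {x : CechCochain f M k} :
    x ∈ cechGrading f δ ℳ k g ↔ ∀ I, x I ∈ locGrading f δ ℳ I.1 g := by
  simp [cechGrading, AddSubgroup.mem_pi]

include hf in
theorem locMap_mem_locGrading {I J : Finset (Fin r)} (h : I ⊆ J) {g : G}
    {x : LocalizedModule (pows f I) M} (hx : x ∈ locGrading f δ ℳ I g) :
    locMap f M h x ∈ locGrading f δ ℳ J g := by
  obtain ⟨t, m, hm, rfl⟩ := (mem_locGrading hf).1 hx
  rw [locMap_frac]
  refine frac_mem_locGrading ?_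
  have h1 := (HomogeneousSMul.prod (J \ I) fun i _ => hf i).pow t _ _ hm
  rwa [add_assoc, ← smul_add, add_comm (∑ i ∈ I, δ i), Finset.sum_sdiff h] at h1

theorem neg_one_pow_smul_mem {N : Type*} [AddCommGroup N] [Module R N] (A : AddSubgroup N)
    (e : ℕ) {x : N} (hx : x ∈ A) : ((-1 : R) ^ e) • x ∈ A := by
  rcases neg_one_pow_eq_or R e with h | h <;> rw [h]
  · rwa [one_smul]
  · rw [neg_smul, one_smul]; exact neg_mem hx

include hf in
theorem cechD_mem_cechGrading (k : ℕ) (g : G) (x : CechCochain f M k)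
    (hx : x ∈ cechGrading f δ ℳ k g) : cechD f M k x ∈ cechGrading f δ ℳ (k + 1) g := by
  rw [mem_cechGrading] at hx ⊢
  intro J
  rw [cechD_apply]
  refine sum_mem fun i _ => ?_
  exact neg_one_pow_smul_mem (locGrading f δ ℳ J.1 g) _
    (locMap_mem_locGrading hf (Finset.erase_subset i.1 J.1) (hx ⟨J.1.erase i.1, _⟩))

include hf in
theorem smul_mem_cechGrading {p : R} {ε : G} (hp : HomogeneousSMul ℳ p ε)
    (k : ℕ) (g : G) (x : CechCochain f M k) (hx : x ∈ cechGrading f δ ℳ k g) :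
    p • x ∈ cechGrading f δ ℳ k (g + ε) := by
  rw [mem_cechGrading] at hx ⊢
  intro J
  obtain ⟨t, m, hm, e⟩ := (mem_locGrading hf).1 (hx J)
  rw [Pi.smul_apply, e, ← map_smul]
  refine frac_mem_locGrading ?_
  rw [add_right_comm]
  exact hp _ _ hm

include hf in
/-- A homogeneous Čech coboundary is the coboundary of a homogeneous cochain. -/
theorem exists_mem_cechGrading_cechD_eq [DecidableEq G] [DirectSum.Decomposition ℳ] {k : ℕ} {g : G}
    {y : CechCochain f M k} (hy : cechD f M k y ∈ cechGrading f δ ℳ (k + 1) g) :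
    ∃ z ∈ cechGrading f δ ℳ k g, cechD f M k z = cechD f M k y := by
  obtain ⟨t, m, hm⟩ := exists_forall_frac f y
  let m' : {I : Finset (Fin r) // I.card = k} → M := fun I =>
    DirectSum.decompose ℳ (m I) (g + t • ∑ i ∈ I.1, δ i)
  -- With a common exponent `t`, the numerators of `d x` are sums of homogeneous multiples of those
  -- of `x`. Taking components therefore commutes with `d`, and by `frac_decompose` it does not
  -- change the homogeneous cochain `d y`.
  have key : ∀ (x : CechCochain f M k) (m : {I : Finset (Fin r) // I.card = k} → M),
      (∀ I, x I = frac f I.1 t (m I)) → ∀ J, cechD f M k x J = frac f J.1 t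
        (∑ i : {i // i ∈ J.1}, ((-1 : R) ^ (J.1.filter (· < i.1)).card) •
          (∏ i ∈ J.1 \ J.1.erase i.1, f i) ^ t • m ⟨J.1.erase i.1, by
            rw [Finset.card_erase_of_mem i.2, J.2, Nat.add_sub_cancel]⟩) := by
    intro x m hm J
    rw [cechD_apply, map_sum]
    refine Finset.sum_congr rfl fun i _ => ?_
    rw [hm, locMap_frac]
    exact ((frac f J.1 t).map_smul _ _).symm
  refine ⟨fun I => frac f I.1 t (m' I), mem_cechGrading.2 fun I =>
    frac_mem_locGrading (SetLike.coe_mem _), ?_⟩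
  ext1 J
  have h1 := mem_cechGrading.1 hy J
  rw [key y m hm J] at h1 ⊢
  rw [key _ m' (fun _ => rfl) J, ← frac_decompose hf h1]
  congr 1
  rw [DirectSum.decompose_sum, DFinsupp.finsetSum_apply, AddSubgroup.val_finsetSum]
  refine Finset.sum_congr rfl fun i _ => ?_
  have h2 : (DirectSum.decompose ℳ ((∏ i ∈ J.1 \ J.1.erase i.1, f i) ^ t • m ⟨J.1.erase i.1, by
      rw [Finset.card_erase_of_mem i.2, J.2, Nat.add_sub_cancel]⟩)
        (g + t • ∑ i ∈ J.1, δ i) : M) = _ :=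
    ((HomogeneousSMul.prod (J.1 \ J.1.erase i.1) fun i _ => hf i).pow t).decompose_smul _
      (b := g + t • ∑ i ∈ J.1.erase i.1, δ i) (by
        rw [add_assoc, ← smul_add, add_comm (∑ i ∈ J.1.erase i.1, δ i),
          Finset.sum_sdiff (Finset.erase_subset _ _)])
  rcases neg_one_pow_eq_or R (J.1.filter (· < i.1)).card with h | h <;> rw [h]
  · rw [one_smul, one_smul, h2]
  · rw [neg_smul, neg_smul, one_smul, one_smul, DirectSum.decompose_neg, DFinsupp.neg_apply,
      AddSubgroup.coe_neg, h2]

end Fractions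

/-! ### Homogeneous components of polynomials. -/

section WeightedHomogeneous

variable {S : Type*} [CommRing S] {n : ℕ} {G : Type*} [AddCommGroup G] {γ : Fin n → G}

theorem weightedHomogeneousComponent_mul {p : MvPolynomial (Fin n) S} {a : G}
    (hp : p ∈ weightedHomogeneousSubmodule S γ a) (q : MvPolynomial (Fin n) S) {b c : G}
    (h : a + b = c) :
    weightedHomogeneousComponent γ c (p * q) = p * weightedHomogeneousComponent γ b q := by
  subst h
  induction q using MvPolynomial.induction_on' with
  | monomial d s =>
    have h1 := isWeightedHomogeneous_monomial γ d s rfl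
    have h2 : IsWeightedHomogeneous γ (p * monomial d s) _ := IsWeightedHomogeneous.mul hp h1
    by_cases hd : Finsupp.weight γ d = b
    · subst hd
      rw [h1.weightedHomogeneousComponent_same, h2.weightedHomogeneousComponent_same]
    · rw [h1.weightedHomogeneousComponent_ne _ (Ne.symm hd), mul_zero,
        h2.weightedHomogeneousComponent_ne _ (by simpa using Ne.symm hd)]
  | add q q' h h' => simp only [mul_add, map_add, h, h']

/-- Any expression of `p` through the variables becomes homogeneous on replacing the coefficient of
`X_i` by its component of degree `ε - γ_i`. -/
theorem exists_eq_sum_X_mul {p : MvPolynomial (Fin n) S} {ε : G}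
    (hp : p ∈ weightedHomogeneousSubmodule S γ ε)
    (hX : p ∈ Ideal.span (Set.range (X : Fin n → MvPolynomial (Fin n) S))) :
    ∃ q : Fin n → MvPolynomial (Fin n) S,
      (∀ i, q i ∈ weightedHomogeneousSubmodule S γ (ε - γ i)) ∧ p = ∑ i, X i * q i := by
  obtain ⟨c, hc⟩ := (Ideal.mem_span_range_iff_exists_fun).1 hX
  refine ⟨fun i => weightedHomogeneousComponent γ (ε - γ i) (c i),
    fun i => weightedHomogeneousComponent_mem γ (c i) _, ?_⟩
  rw [← IsWeightedHomogeneous.weightedHomogeneousComponent_same hp, ← hc, map_sum]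
  refine Finset.sum_congr rfl fun i _ => ?_
  rw [mul_comm]
  exact weightedHomogeneousComponent_mul (isWeightedHomogeneous_X S γ i) _ (by abel)

theorem HomogeneousSMul.of_mem {M : Type*} [AddCommGroup M] [Module (MvPolynomial (Fin n) S) M]
    {ℳ : G → AddSubgroup M} [SetLike.GradedSMul (weightedHomogeneousSubmodule S γ) ℳ]
    {p : MvPolynomial (Fin n) S} {ε : G} (hp : p ∈ weightedHomogeneousSubmodule S γ ε) :
    HomogeneousSMul ℳ p ε := fun g m hm => by
  rw [add_comm, ← vadd_eq_add]
  exact SetLike.GradedSMul.smul_mem hp hm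

end WeightedHomogeneous

/-! ### From vanishing of graded local cohomology to coboundaries, and the identification of `Č⁰`
with `M`. -/

section CechAcyclic

variable {R : Type*} [CommRing R] {M : Type*} [AddCommGroup M] [Module R M]
variable {r : ℕ} {f : Fin r → R} {G : Type*} [AddCommGroup G] {δ : Fin r → G}
  {ℳ : G → AddSubgroup M}

/-- The cochain bounding `x` need not be homogeneous here; `exists_mem_cechGrading_cechD_eq` repairs
that. -/
theorem mem_cechBoundaries_of_locCohGrading_eq_bot {k : ℕ} {g : G}
    (h : locCohGrading f δ ℳ k g = ⊥) {x : CechCochain f M k}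
    (hx : x ∈ cechGrading f δ ℳ k g) (hdx : cechD f M k x = 0) : x ∈ cechBoundaries f M k := by
  have h1 : Submodule.mkQ ((cechBoundaries f M k).comap (LinearMap.ker (cechD f M k)).subtype)
      ⟨x, hdx⟩ ∈ locCohGrading f δ ℳ k g :=
    AddSubgroup.mem_map.2 ⟨⟨x, hdx⟩, hx, rfl⟩
  rw [h, AddSubgroup.mem_bot, Submodule.mkQ_apply, Submodule.Quotient.mk_eq_zero] at h1
  exact h1

variable (f M) in
/-- The canonical map from `M` to the Čech cochains of degree `0`. -/
def toCechZero : M →ₗ[R] CechCochain f M 0 :=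
  LinearMap.pi fun _ => LocalizedModule.mkLinearMap _ _

-- The empty product is `1`, so localizing at `f_∅` changes nothing.
variable (f) in
theorem isUnit_pows_empty (x : pows f ∅) : IsUnit (algebraMap R (Module.End R M) x) := by
  obtain ⟨_, t, rfl⟩ := x
  simp

variable (f M) in
/-- A retraction of `toCechZero`. -/
def fromCechZero : CechCochain f M 0 →ₗ[R] M :=
  LocalizedModule.lift (pows f ∅) LinearMap.id (isUnit_pows_empty f) ∘ₗ
    LinearMap.proj (R := R) (φ := fun I : {I : Finset (Fin r) // I.card = 0} =>
      LocalizedModule (pows f I.1) M) ⟨∅, Finset.card_empty⟩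

theorem fromCechZero_toCechZero (m : M) : fromCechZero M f (toCechZero M f m) = m := by
  rw [fromCechZero, LinearMap.comp_apply]
  exact LinearMap.congr_fun (LocalizedModule.lift_comp (pows f ∅) LinearMap.id
    (isUnit_pows_empty f)) m

theorem toCechZero_mem {g : G} {m : M} (hm : m ∈ ℳ g) :
    toCechZero M f m ∈ cechGrading f δ ℳ 0 g := by
  rw [mem_cechGrading]
  intro I
  have h : toCechZero M f m I = frac f I.1 0 m := by
    rw [frac_apply]
    exact congrArg (LocalizedModule.mk m) (Subtype.ext (pow_zero _).symm)
  rw [h]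
  exact frac_mem_locGrading (by rwa [zero_smul, add_zero])

end CechAcyclic

/-! ### Vanishing of Koszul homology in degree `a`. -/

section Vanishing

variable {S : Type*} [CommRing S] {n : ℕ} {G : Type*} [AddCommGroup G] [DecidableEq G]
  {γ : Fin n → G} {r : ℕ} {f : Fin r → MvPolynomial (Fin n) S} {δ : Fin r → G}
  {M : Type*} [AddCommGroup M] [Module (MvPolynomial (Fin n) S) M]
  {ℳ : G → AddSubgroup M} [DirectSum.Decomposition ℳ]
  [SetLike.GradedSMul (weightedHomogeneousSubmodule S γ) ℳ]

/-- A homogeneous Koszul cycle of degree `a` with coefficients in `M` is a boundary if the local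
cohomology of `M` vanishes in the relevant degrees. -/
theorem exists_koszulD_eq_of_locCohGrading_eq_bot
    (hfX : ∀ i, f i ∈ Ideal.span (Set.range (X : Fin n → MvPolynomial (Fin n) S)))
    (hf : ∀ i, f i ∈ weightedHomogeneousSubmodule S γ (δ i)) (a : G) (j : ℕ)
    (h : ∀ (k : ℕ) (I : Finset (Fin n)), I.card = j + k →
      locCohGrading f δ ℳ k (a - ∑ i ∈ I, γ i) = ⊥)
    (c : Finset (Fin n) → M) (hc : SuppCard j c) (hca : HomogeneousFamily γ ℳ a c)
    (hdc : koszulD (S := S) M c = 0) :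
    ∃ b : Finset (Fin n) → M, SuppCard (j + 1) b ∧ koszulD (S := S) M b = c := by
  have hfs : ∀ i, HomogeneousSMul ℳ (f i) (δ i) := fun i => .of_mem (hf i)
  -- `J` is nonempty, so `f_J` is a multiple of some `f_i` and lies in `(X_1, …, X_n)`.
  have hq : ∀ (k : ℕ) (J : {J : Finset (Fin r) // J.card = k + 1}),
      ∃ q : Fin n → MvPolynomial (Fin n) S,
        (∀ i, q i ∈ weightedHomogeneousSubmodule S γ (∑ i ∈ J.1, δ i - γ i)) ∧
          ∏ i ∈ J.1, f i = ∑ i, X i * q i := fun k J => by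
    obtain ⟨i, hi⟩ := Finset.card_pos.1 (by rw [J.2]; omega : 0 < J.1.card)
    exact exists_eq_sum_X_mul (IsWeightedHomogeneous.prod _ _ _ fun i _ => hf i)
      (Ideal.mem_of_dvd _ (Finset.dvd_prod_of_mem f hi) (hfX i))
  choose q hqh hqs using hq
  -- On the component `J`, `u k i` is multiplication by `q_i / f_J`, of degree `-γ_i`.
  let u : ∀ k, Fin n → CechCochain f M (k + 1) →ₗ[MvPolynomial (Fin n) S]
      CechCochain f M (k + 1) := fun k i => LinearMap.pi fun J =>
    q k J i • (LocalizedModule.divBy (⟨∏ i ∈ J.1, f i, 1, pow_one _⟩ : pows f J.1) ∘ₗ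
      LinearMap.proj J)
  obtain ⟨b, hb, hbc⟩ := exists_koszulD_eq_of_acyclic (C := CechCochain f M) (cechD f M)
    (cechD_comp f) (cechGrading f δ ℳ)
    (fun k i g x hx => smul_mem_cechGrading hfs (.of_mem (isWeightedHomogeneous_X S γ i)) k g x hx)
    (cechD_mem_cechGrading hfs) u
    (fun k x => by
      ext1 J
      have e : ∀ i, ((X i : MvPolynomial (Fin n) S) • u k i x) J = (X i * q k J i) •
          LocalizedModule.divBy (⟨∏ i ∈ J.1, f i, 1, pow_one _⟩ : pows f J.1) (x J) := fun i => by
        rw [mul_smul]; rfl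
      rw [Finset.sum_apply, Finset.sum_congr rfl fun i _ => e i, ← Finset.sum_smul, ← hqs]
      exact LocalizedModule.mul_by_divBy (⟨∏ i ∈ J.1, f i, 1, pow_one _⟩ : pows f J.1) (x J))
    (fun k i g x hx => by
      rw [mem_cechGrading] at hx ⊢
      intro J
      obtain ⟨t, m, hm, e⟩ := (mem_locGrading hfs).1 (hx J)
      have e' : u k i x J = frac f J.1 (t + 1) (q k J i • m) := by
        rw [map_smul, ← divBy_frac, ← e]; rfl
      rw [e']
      refine frac_mem_locGrading ?_
      have h1 := HomogeneousSMul.of_mem (ℳ := ℳ) (hqh k J i) _ _ hm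
      convert h1 using 2
      rw [add_smul, one_smul]
      abel)
    (r := r) (fun k hk => by
      have : IsEmpty {I : Finset (Fin r) // I.card = k} := ⟨fun I => by
        have := Finset.card_le_univ I.1
        rw [I.2, Fintype.card_fin] at this
        omega⟩
      infer_instance)
    a j
    (fun k I hI x hx hdx => by
      obtain ⟨y, rfl⟩ := mem_cechBoundaries_of_locCohGrading_eq_bot (h (k + 1) I hI) hx hdx
      exact exists_mem_cechGrading_cechD_eq hfs hx)
    (fun I hI x hx hdx =>
      mem_cechBoundaries_of_locCohGrading_eq_bot (h 0 I hI) hx hdx)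
    (toCechZero M f ∘ c) (hc.comp (toCechZero M f).toAddMonoidHom)
    (fun I => toCechZero_mem (hca I)) (by rw [koszulD_comp, hdc]; ext I; simp)
  -- The bounding chain has coefficients in `Č⁰`; the linear retraction brings it back to `M`.
  refine ⟨fromCechZero M f ∘ b, hb.comp (fromCechZero M f).toAddMonoidHom, ?_⟩
  rw [koszulD_comp, hbc]
  ext I
  exact fromCechZero_toCechZero (c I)

end Vanishing

/-! ### The degree `0` part of a map into the Koszul complex. -/

section DegreeZeroPart

variable {S : Type u} [CommRing S] {n : ℕ} {G : Type v} [AddCommGroup G] (γ : Fin n → G)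

/-- The homogeneous component of degree `b` of an element of the Koszul complex. -/
def koszulComponent (l : ℕ) (b : G) : koszulTerm S n l →+ koszulTerm S n l where
  toFun c := ⟨fun I => weightedHomogeneousComponent γ (b - ∑ i ∈ I, γ i) (c.1 I), fun I hI => by
    simp only [c.2 I hI, map_zero]⟩
  map_zero' := by ext1; ext1 I; exact map_zero _
  map_add' c c' := by ext1; ext1 I; exact map_add _ _ _

variable {γ}

theorem koszulComponent_apply (l : ℕ) (b : G) (c : koszulTerm S n l) (I : Finset (Fin n)) :
    (koszulComponent γ l b c).1 I =
      weightedHomogeneousComponent γ (b - ∑ i ∈ I, γ i) (c.1 I) := rfl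

theorem koszulComponent_smul (l : ℕ) {a : G} (b : G) {p : MvPolynomial (Fin n) S}
    (hp : p ∈ weightedHomogeneousSubmodule S γ a) (c : koszulTerm S n l) :
    koszulComponent γ l (a + b) (p • c) = p • koszulComponent γ l b c := by
  ext1; ext1 I
  exact weightedHomogeneousComponent_mul hp (c.1 I) (by abel)

/-- The differential has degree `0`: `ι_i` removes the degree `γ_i` of `e_i` and `X_i` restores it.
Hence the degree `0` part of a chain map is a chain map. -/
theorem koszulComponent_koszulTermD (l : ℕ) (b : G) (c : koszulTerm S n (l + 1)) :
    koszulComponent γ l b (koszulTermD S n l c) =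
      koszulTermD S n l (koszulComponent γ (l + 1) b c) := by
  ext1; ext1 I
  rw [koszulComponent_apply]
  change weightedHomogeneousComponent γ _ (koszulD (S := S) _ c.1 I) = koszulD (S := S) _ _ I
  simp only [koszulD_apply, Finset.sum_apply, Pi.smul_apply, smul_eq_mul, map_sum, contract_apply]
  refine Finset.sum_congr rfl fun i _ => ?_
  split_ifs with hi
  · simp
  · refine (weightedHomogeneousComponent_mul (isWeightedHomogeneous_X S γ i) _
      (b := b - ∑ i ∈ insert i I, γ i) ?_).trans ?_
    · rw [Finset.sum_insert hi]
      abel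
    · rw [map_zsmul]; rfl

variable [DecidableEq G] {N : Type*} [AddCommGroup N] [Module (MvPolynomial (Fin n) S) N]
  (𝒩 : G → AddSubgroup N) [DirectSum.Decomposition 𝒩]

/-- The degree `0` part of a map from a graded module to a term of the Koszul complex, as an
additive map. -/
def degreeZeroAux {l : ℕ} (L : N →ₗ[MvPolynomial (Fin n) S] koszulTerm S n l) :
    N →+ koszulTerm S n l :=
  (DirectSum.toAddMonoid fun b =>
    (koszulComponent γ l b).comp (L.toAddMonoidHom.comp (𝒩 b).subtype)).comp
      (DirectSum.decomposeAddEquiv 𝒩).toAddMonoidHom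

theorem degreeZeroAux_of_mem {l : ℕ} (L : N →ₗ[MvPolynomial (Fin n) S] koszulTerm S n l) {b : G}
    {x : N} (hx : x ∈ 𝒩 b) : degreeZeroAux (γ := γ) 𝒩 L x = koszulComponent γ l b (L x) := by
  have h : degreeZeroAux (γ := γ) 𝒩 L x = DirectSum.toAddMonoid (fun b =>
    (koszulComponent γ l b).comp (L.toAddMonoidHom.comp (𝒩 b).subtype))
      (DirectSum.decompose 𝒩 x) := rfl
  rw [h, DirectSum.decompose_of_mem 𝒩 hx, DirectSum.toAddMonoid_of]
  rfl

/-- The degree `0` part of a map from a graded module to a term of the Koszul complex. -/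
def degreeZero (hsmul : ∀ a b : G, ∀ p ∈ weightedHomogeneousSubmodule S γ a, ∀ x ∈ 𝒩 b,
      p • x ∈ 𝒩 (a + b)) {l : ℕ} (L : N →ₗ[MvPolynomial (Fin n) S] koszulTerm S n l) :
    N →ₗ[MvPolynomial (Fin n) S] koszulTerm S n l where
  __ := degreeZeroAux (γ := γ) 𝒩 L
  map_smul' p x := by
    change degreeZeroAux (γ := γ) 𝒩 L (p • x) = p • degreeZeroAux (γ := γ) 𝒩 L x
    induction x using DirectSum.Decomposition.inductionOn 𝒩 with
    | zero => simp
    | @homogeneous b x =>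
      -- `hsmul` concerns homogeneous scalars, and monomials are homogeneous.
      induction p using MvPolynomial.induction_on' with
      | monomial d s =>
        have h1 : monomial d s ∈ weightedHomogeneousSubmodule S γ (Finsupp.weight γ d) :=
          isWeightedHomogeneous_monomial γ d s rfl
        rw [degreeZeroAux_of_mem 𝒩 L x.2, degreeZeroAux_of_mem 𝒩 L (hsmul _ _ _ h1 _ x.2),
          map_smul, koszulComponent_smul l b h1]
      | add p q hp hq => rw [add_smul, map_add, hp, hq, add_smul]
    | add x y hx hy => rw [smul_add, map_add, hx, hy, map_add, smul_add]

theorem degreeZero_of_mem (hsmul : ∀ a b : G, ∀ p ∈ weightedHomogeneousSubmodule S γ a,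
    ∀ x ∈ 𝒩 b, p • x ∈ 𝒩 (a + b)) {l : ℕ} (L : N →ₗ[MvPolynomial (Fin n) S] koszulTerm S n l)
    {b : G} {x : N} (hx : x ∈ 𝒩 b) :
    degreeZero 𝒩 hsmul L x = koszulComponent γ l b (L x) :=
  degreeZeroAux_of_mem 𝒩 L hx

end DegreeZeroPart

/-! ### Comparison of a graded resolution with the Koszul complex. -/

section Comparison

variable {S : Type u} [CommRing S] {n : ℕ} {G : Type v} [AddCommGroup G] [DecidableEq G]
  {γ : Fin n → G} (P : GradedResolution S γ)

instance (i : ℕ) : DirectSum.Decomposition (P.grading i) :=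
  (P.isInternal i).chooseDecomposition

/-- The terms of a chain map from a resolution to the Koszul complex, lifting the identity. -/
def liftToKoszul (i : ℕ) :
    P.res.complex.X i →ₗ[MvPolynomial (Fin n) S] koszulTerm S n i :=
  ((ProjectiveResolution.lift (𝟙 _) P.res (koszulResolution S n)).f i).hom

theorem koszulTermD_liftToKoszul (i : ℕ) (x : P.res.complex.X (i + 1)) :
    koszulTermD S n i (liftToKoszul P (i + 1) x) =
      liftToKoszul P i (P.res.complex.d (i + 1) i x) := by
  have h1 := ConcreteCategory.congr_hom
    ((ProjectiveResolution.lift (𝟙 _) P.res (koszulResolution S n)).comm (i + 1) i) x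
  change (koszulComplex S n).d (i + 1) i _ = _ at h1
  rw [koszulComplex_d] at h1
  exact h1

theorem koszulAug_liftToKoszul (x : P.res.complex.X 0) :
    koszulAug S n (liftToKoszul P 0 x) = P.res.π.f 0 x := by
  have h0 := ProjectiveResolution.lift_commutes_zero (𝟙 _) P.res (koszulResolution S n)
  rw [koszulResolution_π_zero] at h0
  exact ConcreteCategory.congr_hom h0 x

/-- The terms of a chain map of degree `0` from a graded resolution to the Koszul complex, lifting
the identity. -/
def toKoszulTerm (i : ℕ) : P.res.complex.X i →ₗ[MvPolynomial (Fin n) S] koszulTerm S n i :=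
  degreeZero (P.grading i) (P.smul_mem i) (liftToKoszul P i)

theorem toKoszulTerm_of_mem {i : ℕ} {b : G} {x : P.res.complex.X i} (hx : x ∈ P.grading i b) :
    toKoszulTerm P i x = koszulComponent γ i b (liftToKoszul P i x) :=
  degreeZero_of_mem (P.grading i) (P.smul_mem i) _ hx

theorem koszulTermD_toKoszulTerm (i : ℕ) (x : P.res.complex.X (i + 1)) :
    koszulTermD S n i (toKoszulTerm P (i + 1) x) =
      toKoszulTerm P i (P.res.complex.d (i + 1) i x) := by
  induction x using DirectSum.Decomposition.inductionOn (P.grading (i + 1)) with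
  | zero => simp
  | @homogeneous b x =>
    rw [toKoszulTerm_of_mem P x.2, toKoszulTerm_of_mem P (P.d_mem (i + 1) i b _ x.2),
      ← koszulComponent_koszulTermD, koszulTermD_liftToKoszul]
  | add x y hx hy => simp only [map_add, hx, hy]

/-- On elements of degree `b ≠ 0` both sides vanish, as constants have degree `0` and `S` sits in
degree `0`; for `b = 0`, taking the component keeps the constant term. -/
theorem koszulAug_toKoszulTerm (x : P.res.complex.X 0) :
    koszulAug S n (toKoszulTerm P 0 x) = P.res.π.f 0 x := by
  induction x using DirectSum.Decomposition.inductionOn (P.grading 0) with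
  | zero => simp only [map_zero]; rfl
  | @homogeneous b x =>
    rw [toKoszulTerm_of_mem P x.2]
    have h2 := koszulAug_liftToKoszul P x.1
    change (constantCoeff (weightedHomogeneousComponent γ (b - ∑ i ∈ ∅, γ i)
      ((liftToKoszul P 0 x.1).1 ∅)) : S) = _
    rw [Finset.sum_empty, sub_zero, constantCoeff_eq, coeff_weightedHomogeneousComponent, map_zero]
    split_ifs with hb
    · exact h2
    · exact (P.augmentation_eq_zero b (Ne.symm hb) _ x.2).symm
  | add x y hx hy => rw [map_add, map_add, hx, hy, map_add]; rfl

/-- The chain map with terms `toKoszulTerm`. -/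
def toKoszul : P.res.complex ⟶ (koszulResolution S n).complex where
  f i := ModuleCat.ofHom (toKoszulTerm P i)
  comm' := by
    rintro _ i rfl
    change _ ≫ (koszulComplex S n).d (i + 1) i = _
    rw [koszulComplex_d]
    exact ModuleCat.hom_ext (LinearMap.ext fun x => koszulTermD_toKoszulTerm P i x)

/-- The terms of a chain map from the Koszul complex to a resolution, lifting the identity. -/
def fromKoszulTerm (i : ℕ) : koszulTerm S n i →ₗ[MvPolynomial (Fin n) S] P.res.complex.X i :=
  ((ProjectiveResolution.lift (𝟙 _) (koszulResolution S n) P.res).f i).hom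

theorem d_fromKoszulTerm (i : ℕ) (c : koszulTerm S n (i + 1)) :
    P.res.complex.d (i + 1) i (fromKoszulTerm P (i + 1) c) =
      fromKoszulTerm P i (koszulTermD S n i c) := by
  have h1 := (ProjectiveResolution.lift (𝟙 _) (koszulResolution S n) P.res).comm (i + 1) i
  change _ = (koszulComplex S n).d (i + 1) i ≫ _ at h1
  rw [koszulComplex_d] at h1
  exact ConcreteCategory.congr_hom h1 c

/-- The composition of the comparison maps is homotopic to the identity. -/
def toKoszulFromKoszulHomotopy :
    Homotopy (toKoszul P ≫ ProjectiveResolution.lift (𝟙 _) (koszulResolution S n) P.res)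
      (𝟙 P.res.complex) :=
  ProjectiveResolution.liftHomotopy (𝟙 _) (P := P.res) (Q := P.res) _ _
    (by
      have h : toKoszul P ≫ (koszulResolution S n).π = P.res.π := by
        refine HomologicalComplex.to_single_hom_ext ?_
        change (toKoszul P).f 0 ≫ (koszulResolution S n).π.f 0 = _
        rw [koszulResolution_π_zero]
        exact ModuleCat.hom_ext (LinearMap.ext fun x => koszulAug_toKoszulTerm P x)
      have h1 := ProjectiveResolution.lift_commutes (𝟙 _) (koszulResolution S n) P.res
      rw [Category.assoc, h1, ← Category.assoc, h])
    (by simp)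

/-- The terms of the homotopy `toKoszulFromKoszulHomotopy`. -/
def homotopyTerm (i : ℕ) :
    P.res.complex.X i →ₗ[MvPolynomial (Fin n) S] P.res.complex.X (i + 1) :=
  ((toKoszulFromKoszulHomotopy P).hom i (i + 1)).hom

theorem fromKoszulTerm_toKoszulTerm_zero (x : P.res.complex.X 0) :
    fromKoszulTerm P 0 (toKoszulTerm P 0 x) =
      P.res.complex.d 1 0 (homotopyTerm P 0 x) + x := by
  have h := (toKoszulFromKoszulHomotopy P).comm 0
  rw [Homotopy.dNext_zero_chainComplex, Homotopy.prevD_chainComplex, zero_add] at h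
  exact ConcreteCategory.congr_hom h x

theorem fromKoszulTerm_toKoszulTerm_succ (i : ℕ) (x : P.res.complex.X (i + 1)) :
    fromKoszulTerm P (i + 1) (toKoszulTerm P (i + 1) x) =
      homotopyTerm P i (P.res.complex.d (i + 1) i x) +
        P.res.complex.d (i + 2) (i + 1) (homotopyTerm P (i + 1) x) + x := by
  have h := (toKoszulFromKoszulHomotopy P).comm (i + 1)
  rw [Homotopy.dNext_succ_chainComplex, Homotopy.prevD_chainComplex] at h
  exact ConcreteCategory.congr_hom h x

end Comparison

/-! ### Transfer between `M ⊗ P` and the Koszul complex of `M`. -/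

section Tensor

variable {S : Type u} [CommRing S] {n : ℕ}

/-- This makes `koszulToTensor` compatible with differentials on all families, without a support
condition. -/
theorem koszulProj_koszulD (l : ℕ) (c : Finset (Fin n) → MvPolynomial (Fin n) S) :
    koszulProj l (koszulD (S := S) _ c) = koszulTermD S n l (koszulProj (l + 1) c) := by
  ext1; ext1 I
  change (if I.card = l then koszulD (S := S) _ c I else 0) =
    koszulD (S := S) _ (fun I => if I.card = l + 1 then c I else 0) I
  simp only [koszulD_apply, Finset.sum_apply, Pi.smul_apply, contract_apply]
  by_cases h : I.card = l
  · rw [if_pos h]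
    refine Finset.sum_congr rfl fun i _ => ?_
    by_cases hi : i ∈ I
    · simp [hi]
    · simp [hi, h]
  · rw [if_neg h]
    refine (Finset.sum_eq_zero fun i _ => ?_).symm
    by_cases hi : i ∈ I
    · simp [hi]
    · simp [hi, h]

theorem koszulProj_eq_sum (l : ℕ) (c : Finset (Fin n) → MvPolynomial (Fin n) S) :
    koszulProj l c = ∑ I, c I • koszulProj l (Pi.single I 1) := by
  conv_lhs => rw [← Finset.univ_sum_single c, map_sum]
  refine Finset.sum_congr rfl fun I _ => ?_
  rw [← map_smul, ← Pi.single_smul, smul_eq_mul, mul_one]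

theorem koszulD_smul_const {M : Type*} [AddCommGroup M] [Module (MvPolynomial (Fin n) S) M]
    (c : Finset (Fin n) → MvPolynomial (Fin n) S) (m : M) :
    koszulD (S := S) M (fun I => c I • m) = fun I => koszulD (S := S) _ c I • m :=
  koszulD_comp (LinearMap.toSpanSingleton (MvPolynomial (Fin n) S) M m) c

variable {G : Type v} [AddCommGroup G] [DecidableEq G] {γ : Fin n → G}
  (P : GradedResolution S γ) (M : Type u) [AddCommGroup M] [Module (MvPolynomial (Fin n) S) M]

/-- The comparison map from `M ⊗ P_i` to the Koszul complex with coefficients in `M`. -/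
def tensorToKoszul (i : ℕ) :
    M ⊗[MvPolynomial (Fin n) S] P.res.complex.X i →ₗ[MvPolynomial (Fin n) S]
      (Finset (Fin n) → M) :=
  TensorProduct.lift (LinearMap.mk₂ _ (fun m x I => (toKoszulTerm P i x).1 I • m)
    (fun m m' x => by ext I; simp) (fun p m x => by ext I; exact smul_comm _ _ _)
    (fun m x x' => by ext I; simp [add_smul]) (fun p m x => by ext I; simp [mul_smul]))

/-- The comparison map from the Koszul complex with coefficients in `M` to `M ⊗ P_i`. -/
def koszulToTensor (i : ℕ) : (Finset (Fin n) → M) →ₗ[MvPolynomial (Fin n) S]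
    M ⊗[MvPolynomial (Fin n) S] P.res.complex.X i :=
  ∑ I, (TensorProduct.mk (MvPolynomial (Fin n) S) M (P.res.complex.X i)).flip
    (fromKoszulTerm P i (koszulProj i (Pi.single I 1))) ∘ₗ LinearMap.proj I

/-- The differential of `M ⊗ P`. -/
abbrev tensorD (i j : ℕ) :
    M ⊗[MvPolynomial (Fin n) S] P.res.complex.X i →ₗ[MvPolynomial (Fin n) S]
      M ⊗[MvPolynomial (Fin n) S] P.res.complex.X j :=
  LinearMap.lTensor M (P.res.complex.d i j).hom

variable {M}

theorem tensorToKoszul_tmul (i : ℕ) (m : M) (x : P.res.complex.X i) :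
    tensorToKoszul P M i (m ⊗ₜ x) = fun I => (toKoszulTerm P i x).1 I • m := rfl

theorem koszulToTensor_apply (i : ℕ) (w : Finset (Fin n) → M) :
    koszulToTensor P M i w =
      ∑ I, w I ⊗ₜ fromKoszulTerm P i (koszulProj i (Pi.single I 1)) := by
  simp [koszulToTensor]

theorem koszulToTensor_smul_const (i : ℕ) (c : Finset (Fin n) → MvPolynomial (Fin n) S) (m : M) :
    koszulToTensor P M i (fun I => c I • m) = m ⊗ₜ fromKoszulTerm P i (koszulProj i c) := by
  rw [koszulToTensor_apply, koszulProj_eq_sum, map_sum, TensorProduct.tmul_sum]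
  refine Finset.sum_congr rfl fun I _ => ?_
  rw [map_smul, TensorProduct.tmul_smul, TensorProduct.smul_tmul']

theorem koszulToTensor_tensorToKoszul (i : ℕ)
    (z : M ⊗[MvPolynomial (Fin n) S] P.res.complex.X i) :
    koszulToTensor P M i (tensorToKoszul P M i z) =
      LinearMap.lTensor M (fromKoszulTerm P i ∘ₗ toKoszulTerm P i) z := by
  induction z with
  | zero => simp only [map_zero]
  | tmul m x =>
    rw [tensorToKoszul_tmul, koszulToTensor_smul_const, koszulProj_coe]
    rfl
  | add z z' h h' => simp only [map_add, h, h']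

theorem koszulD_tensorToKoszul (i : ℕ)
    (z : M ⊗[MvPolynomial (Fin n) S] P.res.complex.X (i + 1)) :
    koszulD (S := S) M (tensorToKoszul P M (i + 1) z) =
      tensorToKoszul P M i (tensorD P M (i + 1) i z) := by
  induction z with
  | zero => simp only [map_zero]
  | tmul m x =>
    rw [tensorToKoszul_tmul, koszulD_smul_const, LinearMap.lTensor_tmul, tensorToKoszul_tmul]
    have h := koszulTermD_toKoszulTerm P i x
    ext1 I
    exact congrArg (fun c : koszulTerm S n i => c.1 I • m) h
  | add z z' h h' => simp only [map_add, h, h']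

theorem koszulToTensor_koszulD (i : ℕ) (w : Finset (Fin n) → M) :
    koszulToTensor P M i (koszulD (S := S) M w) =
      tensorD P M (i + 1) i (koszulToTensor P M (i + 1) w) := by
  have key : ∀ (c : Finset (Fin n) → MvPolynomial (Fin n) S) (m : M),
      koszulToTensor P M i (koszulD (S := S) M fun I => c I • m) =
        tensorD P M (i + 1) i (koszulToTensor P M (i + 1) fun I => c I • m) := fun c m => by
    rw [koszulD_smul_const, koszulToTensor_smul_const, koszulToTensor_smul_const,
      koszulProj_koszulD, ← d_fromKoszulTerm]
    rfl
  have hw : w = ∑ J, fun I => (Pi.single J 1 : Finset (Fin n) → MvPolynomial (Fin n) S) I • w J := by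
    ext I
    rw [Finset.sum_apply, Finset.sum_eq_single I]
    · simp
    · intro J _ hJ
      simp [Pi.single_eq_of_ne hJ.symm]
    · simp
  rw [hw]
  simp only [map_sum, key]

theorem suppCard_tensorToKoszul (i : ℕ) (z : M ⊗[MvPolynomial (Fin n) S] P.res.complex.X i) :
    SuppCard i (tensorToKoszul P M i z) := by
  intro I hI
  induction z with
  | zero => simp
  | tmul m x =>
    rw [tensorToKoszul_tmul]
    simp only [(toKoszulTerm P i x).2 I hI, zero_smul]
  | add z z' h h' => rw [map_add, Pi.add_apply, h, h', add_zero]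

/-- This is where the degree `0` part is needed: for `x` of degree `b'`, its coefficient at `I` is a
polynomial of degree `b' - ∑_{i ∈ I} γ_i`. -/
theorem homogeneousFamily_tensorToKoszul {ℳ : G → AddSubgroup M}
    [SetLike.GradedSMul (weightedHomogeneousSubmodule S γ) ℳ] (i : ℕ) {a : G}
    {z : M ⊗[MvPolynomial (Fin n) S] P.res.complex.X i}
    (hz : z ∈ tensorGrading (R := MvPolynomial (Fin n) S) ℳ (P.grading i) a) :
    HomogeneousFamily γ ℳ a (tensorToKoszul P M i z) := by
  intro I
  induction hz using AddSubgroup.closure_induction with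
  | mem z hz =>
    obtain ⟨b, b', m, x, rfl, hm, hx, rfl⟩ := hz
    rw [tensorToKoszul_tmul]
    simp only
    rw [toKoszulTerm_of_mem P hx, koszulComponent_apply]
    have := HomogeneousSMul.of_mem (ℳ := ℳ) (weightedHomogeneousComponent_mem γ
      ((liftToKoszul P i x).1 I) (b' - ∑ i ∈ I, γ i)) _ _ hm
    rwa [← add_sub_assoc] at this
  | zero => rw [map_zero]; exact zero_mem _
  | add z z' _ _ h h' => rw [map_add]; exact add_mem h h'
  | neg z _ h => rw [map_neg]; exact neg_mem h

/-- A cycle of `M ⊗ P` is a boundary if its image in the Koszul complex of `M` is. -/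
theorem mem_range_tensorD (j : ℕ) (z : M ⊗[MvPolynomial (Fin n) S] P.res.complex.X j)
    (hz : ∀ i, tensorD P M j i z = 0) {b : Finset (Fin n) → M}
    (hb : koszulD (S := S) M b = tensorToKoszul P M j z) :
    z ∈ LinearMap.range (tensorD P M (j + 1) j) := by
  have h1 : LinearMap.lTensor M (fromKoszulTerm P j ∘ₗ toKoszulTerm P j) z =
      tensorD P M (j + 1) j (koszulToTensor P M (j + 1) b) := by
    rw [← koszulToTensor_tensorToKoszul, ← hb, koszulToTensor_koszulD]
  have h2 : LinearMap.lTensor M (fromKoszulTerm P j ∘ₗ toKoszulTerm P j) z =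
      tensorD P M (j + 1) j (LinearMap.lTensor M (homotopyTerm P j) z) + z := by
    cases j with
    | zero =>
      have e : fromKoszulTerm P 0 ∘ₗ toKoszulTerm P 0 =
          (P.res.complex.d 1 0).hom ∘ₗ homotopyTerm P 0 + LinearMap.id :=
        LinearMap.ext (fromKoszulTerm_toKoszulTerm_zero P)
      rw [e, LinearMap.lTensor_add, LinearMap.add_apply, LinearMap.lTensor_comp,
        LinearMap.lTensor_id]
      rfl
    | succ j =>
      have e : fromKoszulTerm P (j + 1) ∘ₗ toKoszulTerm P (j + 1) =
          homotopyTerm P j ∘ₗ (P.res.complex.d (j + 1) j).hom +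
            (P.res.complex.d (j + 2) (j + 1)).hom ∘ₗ homotopyTerm P (j + 1) + LinearMap.id :=
        LinearMap.ext (fromKoszulTerm_toKoszulTerm_succ P j)
      -- The summand of the homotopy that starts with the differential dies on the cycle `z`.
      rw [e, LinearMap.lTensor_add, LinearMap.lTensor_add, LinearMap.lTensor_comp,
        LinearMap.lTensor_comp, LinearMap.lTensor_id, LinearMap.add_apply, LinearMap.add_apply,
        LinearMap.comp_apply, hz j, map_zero, zero_add]
      rfl
  refine ⟨koszulToTensor P M (j + 1) b - LinearMap.lTensor M (homotopyTerm P j) z, ?_⟩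
  rw [map_sub, ← h1, h2, add_sub_cancel_left]

theorem cyclesToTor_eq_zero (j : ℕ) (z : (tensorComplex P M).cycles j)
    (hz : (tensorComplex P M).iCycles j z ∈ LinearMap.range (tensorD P M (j + 1) j)) :
    cyclesToTor P M j z = 0 := by
  obtain ⟨w, hw⟩ := hz
  have e : z = (tensorComplex P M).toCycles (j + 1) j w := by
    refine (ModuleCat.mono_iff_injective ((tensorComplex P M).iCycles j)).1 inferInstance ?_
    rw [← hw]
    exact (ConcreteCategory.congr_hom ((tensorComplex P M).toCycles_i (j + 1) j) w).symm
  have h0 : (tensorComplex P M).homologyπ j z = 0 := by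
    rw [e]
    exact ConcreteCategory.congr_hom ((tensorComplex P M).toCycles_comp_homologyπ (j + 1) j) w
  exact (congrArg (P.res.isoLeftDerivedObj ((tensoringLeft _).obj
    (ModuleCat.of (MvPolynomial (Fin n) S) M)) j).inv.hom h0).trans (map_zero _)

theorem tensorD_iCycles (i j : ℕ) (z : (tensorComplex P M).cycles j) :
    tensorD P M j i ((tensorComplex P M).iCycles j z) = 0 :=
  ConcreteCategory.congr_hom ((tensorComplex P M).iCycles_d j i) z

end Tensor

end GradedLC

end

/-! ### Conclusion. -/

theorem mainTheorem9 {S : Type u} [CommRing S] {n : ℕ}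
    {G : Type v} [AddCommGroup G] [AddGroup.FG G] [DecidableEq G] (γ : Fin n → G)
    (B : Ideal (MvPolynomial (Fin n) S)) (hBX : B ≤ Ideal.span (Set.range X))
    {r : ℕ} (f : Fin r → MvPolynomial (Fin n) S) (δ : Fin r → G)
    (hf : ∀ i, f i ∈ weightedHomogeneousSubmodule S γ (δ i))
    (hfB : Ideal.span (Set.range f) = B)
    {M : Type u} [AddCommGroup M] [Module (MvPolynomial (Fin n) S) M]
    (ℳ : G → AddSubgroup M) [DirectSum.Decomposition ℳ]
    [SetLike.GradedSMul (weightedHomogeneousSubmodule S γ) ℳ]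
    (P : GradedLC.GradedResolution S γ) (j : ℕ) :
    GradedLC.supp (GradedLC.torGrading P ℳ j) ⊆
      ⋃ k : ℕ, (GradedLC.supp (GradedLC.locCohGrading f δ ℳ k) + GradedLC.sumsOf γ (j + k)) := by
  intro a ha
  by_contra hna
  -- A nonzero piece would put `a = (a - ∑_{i ∈ I} γ_i) + ∑_{i ∈ I} γ_i` in the union.
  have hvan : ∀ (k : ℕ) (I : Finset (Fin n)), I.card = j + k →
      GradedLC.locCohGrading f δ ℳ k (a - ∑ i ∈ I, γ i) = ⊥ := fun k I hI => by
    by_contra h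
    exact hna (Set.mem_iUnion.2 ⟨k, Set.mem_add.2
      ⟨a - ∑ i ∈ I, γ i, h, ∑ i ∈ I, γ i, ⟨I, hI, rfl⟩, sub_add_cancel _ _⟩⟩)
  refine ha ((AddSubgroup.eq_bot_iff_forall _).2 fun y hy => ?_)
  obtain ⟨z, hz, rfl⟩ := AddSubgroup.mem_map.1 hy
  refine GradedLC.cyclesToTor_eq_zero P j z ?_
  set x : M ⊗[MvPolynomial (Fin n) S] P.res.complex.X j :=
    (GradedLC.tensorComplex P M).iCycles j z
  have hx : ∀ i, GradedLC.tensorD P M j i x = 0 := fun i => GradedLC.tensorD_iCycles P i j z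
  obtain ⟨b, -, hb⟩ := GradedLC.exists_koszulD_eq_of_locCohGrading_eq_bot
    (fun i => hBX (hfB ▸ Ideal.subset_span (Set.mem_range_self i))) hf a j hvan
    (GradedLC.tensorToKoszul P M j x) (GradedLC.suppCard_tensorToKoszul P j x)
    (GradedLC.homogeneousFamily_tensorToKoszul P j hz) (by
      -- For `j = 0` the family lives on the empty set and is a cycle automatically; otherwise the
      -- cycle condition on `x` is transported.
      cases j with
      | zero => exact GradedLC.koszulD_eq_zero (GradedLC.suppCard_tensorToKoszul P 0 x)
      | succ j => rw [GradedLC.koszulD_tensorToKoszul, hx j, map_zero])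
  exact GradedLC.mem_range_tensorD P j x hx hb
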